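/- **Proposition.** Let $M\subset\mathbb{C}^N$ be a smooth generic real submanifold of real codimension $d$: near each of its points, $M=\{\rho_1=\dots=\rho_d=0\}$ with $\rho=(\rho_1,\dots,\rho_d)$ smooth and real-valued and $\partial\rho_1,\dots,\partial\rho_d$ linearly independent over $\mathbb{C}$. Let $p\in M$. Suppose that, after a local biholomorphic change of coordinates sending $p$ to $0$, the submanifold $M$ is given near $p$, in coordinates $(z,w)\in\mathbb{C}^n\times\mathbb{C}^d$, by the reduced equations $$\mathrm{Im}\,w_k={}^t\bar z A_k z+h_k(z,\mathrm{Re}\,w),\qquad k=1,\dots,d,$$ where $A_1,\dots,A_d$ are Hermitian $n\times n$ matrices and $h=(h_1,\dots,h_d)$ is smooth near $0$ with $h(z,u)=o(|z|^2+|u|)$ as $(z,u)\to 0$. Suppose that condition $(\mathfrak b)$ holds: $$\bigcap_{k=1}^d\mathrm{Ker}\,A_k=\{0\}.$$ Then $M$ is holomorphically nondegenerate (in the formal sense) at $p$, that is, there is no nontrivial formal holomorphic vector field at $p$ tangent to $M$. Here a formal holomorphic vector field at $p$ is $X=\sum_{j=1}^N a_j(Z)\,\partial/\partial Z_j$ with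 $a_j\in\mathbb{C}[[Z-p]]$; it is nontrivial if some $a_j\neq 0$. It is tangent to $M$ at $p$ if, for a local defining function $\rho$ of $M$ near $p$ as above, identified with its Taylor series at $p$ in $\mathbb{C}[[Z-p,\bar Z-\bar p]]$, there are $c_{kl}\in\mathbb{C}[[Z-p,\bar Z-\bar p]]$ with $X\rho_k=\sum_{l=1}^d c_{kl}\rho_l$ for all $k$ (this does not depend on the choice of $\rho$). -/

import Mathlib

open scoped Topology ContDiff

namespace CRGeometry

/-- The Wirtinger derivative `∂f/∂Z_j = (1/2) (∂f/∂x_j - i ∂f/∂y_j)`, where `Z_j = x_j + i y_j`. -/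
noncomputable def dZ {N : ℕ} (j : Fin N) (f : (Fin N → ℂ) → ℂ) : (Fin N → ℂ) → ℂ := fun Z =>
  (1 / 2 : ℂ) * (fderiv ℝ f Z (Pi.single j 1) - Complex.I * fderiv ℝ f Z (Pi.single j Complex.I))

/-- The conjugate Wirtinger derivative `∂f/∂Z̄_j = (1/2) (∂f/∂x_j + i ∂f/∂y_j)`. -/
noncomputable def dZbar {N : ℕ} (j : Fin N) (f : (Fin N → ℂ) → ℂ) : (Fin N → ℂ) → ℂ := fun Z =>
  (1 / 2 : ℂ) * (fderiv ℝ f Z (Pi.single j 1) + Complex.I * fderiv ℝ f Z (Pi.single j Complex.I))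

/-- The iterated derivative `D_0^{α_0} ⋯ D_{N-1}^{α_{N-1}} f`. -/
def iterD {N : ℕ} (D : Fin N → ((Fin N → ℂ) → ℂ) → ((Fin N → ℂ) → ℂ)) (α : Fin N → ℕ)
    (f : (Fin N → ℂ) → ℂ) : (Fin N → ℂ) → ℂ :=
  (List.finRange N).foldr (fun j g => (D j)^[α j] g) f

/-- The formal Taylor series at `p` of a function on `ℂ^N` that is smooth near `p`, as a power
series in the `2N` variables `Z - p` (indices `Sum.inl j`) and `Z̄ - p̄` (indices `Sum.inr j`):
the coefficient of `(Z - p)^α (Z̄ - p̄)^β` is `(∂_Z^α ∂_Z̄^β f)(p) / (α! β!)`. -/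
noncomputable def taylorSeries {N : ℕ} (f : (Fin N → ℂ) → ℂ) (p : Fin N → ℂ) :
    MvPowerSeries (Fin N ⊕ Fin N) ℂ := fun m =>
  iterD dZ (fun j => m (Sum.inl j)) (iterD dZbar (fun j => m (Sum.inr j)) f) p /
    ((∏ s, (m s).factorial : ℕ) : ℂ)

/-- `ρ = (ρ_1, …, ρ_d)` is a smooth local defining function of `M ⊆ ℂ^N` on the open
neighbourhood `U` of `p`, with `∂ρ_1, …, ∂ρ_d` linearly independent over `ℂ`. -/
structure IsGenericDefiningFunction {N d : ℕ} (M : Set (Fin N → ℂ)) (p : Fin N → ℂ)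
    (U : Set (Fin N → ℂ)) (ρ : (Fin N → ℂ) → Fin d → ℝ) : Prop where
  isOpen : IsOpen U
  mem : p ∈ U
  contDiffOn : ContDiffOn ℝ ∞ ρ U
  zeroSet : ∀ Z ∈ U, Z ∈ M ↔ ρ Z = 0
  generic : ∀ Z ∈ U, LinearIndependent ℂ
    (fun k : Fin d => fun j : Fin N => dZ j (fun W => (ρ W k : ℂ)) Z)

/-- `M` is a smooth generic real submanifold of `ℂ^N` of real codimension `d`. -/
def IsSmoothGenericSubmanifold {N : ℕ} (M : Set (Fin N → ℂ)) (d : ℕ) : Prop :=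
  ∀ p ∈ M, ∃ (U : Set (Fin N → ℂ)) (ρ : (Fin N → ℂ) → Fin d → ℝ),
    IsGenericDefiningFunction M p U ρ

/-- A formal holomorphic vector field `∑_j a_j(Z) ∂/∂Z_j` at a point `p`, given by its
coefficients `a_j ∈ ℂ[[Z - p]]`. -/
abbrev FormalHolVectorField (N : ℕ) : Type := Fin N → MvPowerSeries (Fin N) ℂ

/-- The action of `X = ∑_j a_j(Z) ∂/∂Z_j` on a formal series in `(Z - p, Z̄ - p̄)`. -/
noncomputable def FormalHolVectorField.act {N : ℕ} (X : FormalHolVectorField N)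
    (F : MvPowerSeries (Fin N ⊕ Fin N) ℂ) : MvPowerSeries (Fin N ⊕ Fin N) ℂ :=
  ∑ j, MvPowerSeries.rename Sum.inl (X j) * MvPowerSeries.pderiv ℂ (Sum.inl j) F

/-- `X` is tangent at `p` to the generic submanifold `M` of codimension `d`: for a local defining
function `ρ` near `p`, with Taylor series again written `ρ`, there are formal power series `c_{kl}`
in `(Z - p, Z̄ - p̄)` with `X ρ_k = ∑_l c_{kl} ρ_l` for all `k`.
(This does not depend on the choice of `ρ`.) -/
def FormalHolVectorField.IsTangentAt {N : ℕ} (X : FormalHolVectorField N)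
    (M : Set (Fin N → ℂ)) (d : ℕ) (p : Fin N → ℂ) : Prop :=
  ∃ (U : Set (Fin N → ℂ)) (ρ : (Fin N → ℂ) → Fin d → ℝ),
    IsGenericDefiningFunction M p U ρ ∧
    ∃ c : Fin d → Fin d → MvPowerSeries (Fin N ⊕ Fin N) ℂ, ∀ k,
      X.act (taylorSeries (fun Z => (ρ Z k : ℂ)) p) =
        ∑ l, c k l * taylorSeries (fun Z => (ρ Z l : ℂ)) p

/-- `M` is holomorphically nondegenerate (in the formal sense) at `p`: there is no nontrivial
formal holomorphic vector field at `p` tangent to `M`. -/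
def IsFormallyHolNondegenerateAt {N : ℕ} (M : Set (Fin N → ℂ)) (d : ℕ) (p : Fin N → ℂ) : Prop :=
  ¬ ∃ X : FormalHolVectorField N, X ≠ 0 ∧ X.IsTangentAt M d p

/-- After the local biholomorphic change of coordinates `Φ`, with `Φ p = 0`, the set `M` is given
near `p` in the coordinates `(z, w) ∈ ℂ^n × ℂ^d` by the reduced equations
`Im w_k = ᵗz̄ A_k z + h_k(z, Re w)`, with `A_k` Hermitian and `h` smooth and negligible: `h` is
`o(|z|² + |u|)` at `0`, where `u = Re w`. -/
structure IsReducedFormAt {N n d : ℕ} (M : Set (Fin N → ℂ)) (p : Fin N → ℂ)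
    (A : Fin d → Matrix (Fin n) (Fin n) ℂ)
    (Φ : OpenPartialHomeomorph (Fin N → ℂ) ((Fin n → ℂ) × (Fin d → ℂ)))
    (h : (Fin n → ℂ) × (Fin d → ℝ) → Fin d → ℝ) : Prop where
  hermitian : ∀ k, (A k).IsHermitian
  mem_source : p ∈ Φ.source
  map_base : Φ p = 0
  holomorphic : DifferentiableOn ℂ Φ Φ.source
  holomorphic_symm : DifferentiableOn ℂ Φ.symm Φ.target
  smooth : ∃ V ∈ 𝓝 (0 : (Fin n → ℂ) × (Fin d → ℝ)), ContDiffOn ℝ ∞ h V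
  negligible : h =o[𝓝 0] (fun x : (Fin n → ℂ) × (Fin d → ℝ) => ‖x.1‖ ^ 2 + ‖x.2‖)
  equation : ∀ᶠ Z in 𝓝 p, Z ∈ M ↔ ∀ k, (((Φ Z).2 k).im : ℂ) =
    star (Φ Z).1 ⬝ᵥ (A k).mulVec (Φ Z).1 + (h ((Φ Z).1, fun l => ((Φ Z).2 l).re) k : ℂ)

/-- Condition (b): the matrices `A_1, …, A_d` have no common nonzero kernel vector. -/
def ConditionB {n d : ℕ} (A : Fin d → Matrix (Fin n) (Fin n) ℂ) : Prop :=
  ⨅ k, LinearMap.ker (A k).mulVecLin = ⊥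

end CRGeometry

/-! Tangency says that the coefficients `X j` satisfy `∑ ∂ρ_k/∂Z_j · X_j ∈ I`, where `I` is the
ideal generated by the Taylor series of `ρ`. Genericity lets any derivation be corrected by the
`∂/∂Z̄_j` until it kills every `ρ_k`; it then preserves `I`, and its action on holomorphic series is
unchanged. Corrected antiholomorphic derivations kill the `X_j`, so applying them to the tangency
relations yields new relations whose constant terms are Levi form entries. If the Levi form has no
kernel on the complex tangent space, the constant terms of all these rows span `ℂ^N`, and inverting
a square matrix of such rows puts each `X_j` in `I` (`forall_mem_of_constantCoeff_rows`). A
holomorphic series in `I` vanishes, since corrected `∂/∂Z_i` keep all its derivatives in `I` and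
elements of `I` have no constant term (`eq_zero_of_rename_mem_span`).

It remains to read condition (b) on the Levi form of an arbitrary `ρ`, without transporting series
through `Φ`. Let `g = Im w_k ∘ Φ`. On `M` it agrees to second order, in complex tangent directions,
with the quadratic form of `A_k`; its differential at `p` is `T ∘ dρ`, and `g` is pluriharmonic.
Second-order limits along curves in `M` compute the Hessian of `g - T ρ`; averaging over
multiplication by `i` removes `g` and expresses the form of `A_k` through the Levi form of `ρ`
(`exists_levi_form_eq`). A Levi-null vector therefore has its `z`-part in every `Ker A_k`, and so is
zero (`eq_zero_of_levi_form_eq_zero`). -/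

namespace CRGeometry

open MvPowerSeries Finsupp

/-! ### Formal power series: 1-nondegeneracy excludes tangent holomorphic fields. -/

section Formal

variable {N d : ℕ}

/-- A matrix of power series whose constant term has linearly independent rows has a right
inverse. -/
theorem exists_right_inverse_of_constantCoeff {σ : Type*} {m n : Type*} [Fintype m] [DecidableEq m]
    [Fintype n] [DecidableEq n] (P : Matrix m n (MvPowerSeries σ ℂ))
    (hP : LinearIndependent ℂ (fun k j => constantCoeff (P k j))) :
    ∃ S : Matrix n m (MvPowerSeries σ ℂ), P * S = 1 := by
  set P₀ : Matrix m n ℂ := P.map constantCoeff with hP₀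
  have hinj : Function.Injective P₀.vecMul := Matrix.vecMul_injective_iff.mpr hP
  obtain ⟨g, hg⟩ := LinearMap.exists_leftInverse_of_injective (P₀.vecMulLinear)
    (LinearMap.ker_eq_bot.mpr hinj)
  obtain ⟨S₀, hS₀⟩ : ∃ S₀ : Matrix n m ℂ, P₀ * S₀ = 1 := by
    refine ⟨(LinearMap.toMatrix' g).transpose, ?_⟩
    ext i j
    have h1 := congrFun (LinearMap.congr_fun hg (Pi.single i 1)) j
    rw [LinearMap.comp_apply, ← LinearMap.toMatrix'_mulVec] at h1
    simp only [Matrix.vecMulLinear_apply, Matrix.single_one_vecMul, LinearMap.id_apply] at h1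
    rw [Matrix.mul_apply, Matrix.one_apply]
    simp only [Matrix.mulVec, dotProduct] at h1
    rw [Pi.single_apply] at h1
    simp only [Matrix.transpose_apply, mul_comm (P₀ i _)]
    simp only [eq_comm (a := i)]
    exact h1
  -- Lift the right inverse of the constant term by constants: the product has constant term 1,
  -- hence unit determinant.
  set S₁ : Matrix n m (MvPowerSeries σ ℂ) := S₀.map C
  set Q := P * S₁ with hQ
  have hQ0 : Q.map constantCoeff = 1 := by
    rw [hQ, Matrix.map_mul, ← hP₀, ← hS₀]
    congr 1
  have hdet : IsUnit Q.det := by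
    rw [MvPowerSeries.isUnit_iff_constantCoeff, RingHom.map_det]
    have : (constantCoeff (σ := σ) (R := ℂ)).mapMatrix Q = 1 := hQ0
    rw [this]; simp
  exact ⟨S₁ * Q⁻¹, by rw [← Matrix.mul_assoc, ← hQ, Matrix.mul_nonsing_inv _ hdet]⟩

theorem pderiv_rename_inl (i : Fin N) (a : MvPowerSeries (Fin N) ℂ) :
    pderiv ℂ (Sum.inl i : Fin N ⊕ Fin N) (rename Sum.inl a) = rename Sum.inl (pderiv ℂ i a) := by
  classical
  ext m
  rw [coeff_pderiv]
  let e : Fin N ↪ Fin N ⊕ Fin N := Function.Embedding.inl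
  by_cases hm : m ∈ Set.range (embDomain e)
  · obtain ⟨x, rfl⟩ := hm
    have h1 : embDomain e x + single (Sum.inl i) 1 = embDomain e (x + single i 1) := by
      rw [embDomain_add, embDomain_single]; rfl
    have h2 : (embDomain e x) (Sum.inl i) = x i := embDomain_apply_self e x i
    have h3 := coeff_embDomain_rename e a (x + single i 1)
    have h4 := coeff_embDomain_rename e (pderiv ℂ i a) x
    rw [h1, h2]
    refine (congrArg (· * ((x i : ℂ) + 1)) h3).trans ?_
    exact (coeff_pderiv a x).symm.trans h4.symm
  -- Any other exponent involves some `Z̄_j`, and both sides have coefficient zero there.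
  · have hz : ∀ x : Fin N →₀ ℕ, ∀ y : Fin N ⊕ Fin N →₀ ℕ,
        mapDomain Sum.inl x = y → ∀ j, y (Sum.inr j) = 0 := by
      rintro x _ rfl j
      exact mapDomain_of_notMem_range _ _ (by simp)
    have hr : ∃ j, m (Sum.inr j) ≠ 0 := by
      by_contra! hcon
      refine hm ⟨m.comapDomain Sum.inl Sum.inl_injective.injOn, ?_⟩
      rw [embDomain_eq_mapDomain]
      refine mapDomain_comapDomain _ Sum.inl_injective m ?_
      intro s hs
      rcases s with s | s
      · exact ⟨s, rfl⟩
      · exact absurd (hcon s) (by simpa using hs)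
    obtain ⟨j, hj⟩ := hr
    rw [coeff_rename_eq_zero, coeff_rename_eq_zero, zero_mul]
    · rintro ⟨x, hx⟩; exact hj (hz x m hx j)
    · rintro ⟨x, hx⟩; exact hj (by simpa using hz x _ hx j)

theorem pderiv_inr_rename_inl (i : Fin N) (a : MvPowerSeries (Fin N) ℂ) :
    pderiv ℂ (Sum.inr i : Fin N ⊕ Fin N) (rename Sum.inl a) = 0 := by
  ext m
  rw [coeff_pderiv, coeff_rename_eq_zero, zero_mul, map_zero]
  rintro ⟨x, hx⟩
  have h1 : (mapDomain Sum.inl x : Fin N ⊕ Fin N →₀ ℕ) (Sum.inr i) = 0 :=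
    mapDomain_of_notMem_range _ _ (by simp)
  rw [hx] at h1
  simp at h1

theorem constantCoeff_pderiv {σ : Type*} (i : σ) (f : MvPowerSeries σ ℂ) :
    constantCoeff (pderiv ℂ i f) = coeff (single i 1) f := by
  rw [← coeff_zero_eq_constantCoeff_apply, coeff_pderiv]; simp

theorem constantCoeff_pderiv_pderiv {σ : Type*} {i j : σ} (hij : i ≠ j) (f : MvPowerSeries σ ℂ) :
    constantCoeff (pderiv ℂ i (pderiv ℂ j f)) = coeff (single j 1 + single i 1) f := by
  classical
  rw [constantCoeff_pderiv, coeff_pderiv, add_comm]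
  simp [hij]

/-- A power series is zero if it lies in a class of series without constant term that is closed
under partial derivatives. -/
theorem eq_zero_of_forall_pderiv {σ : Type*} (S : Set (MvPowerSeries σ ℂ))
    (h0 : ∀ a ∈ S, constantCoeff a = 0) (hS : ∀ a ∈ S, ∀ i, pderiv ℂ i a ∈ S)
    {a : MvPowerSeries σ ℂ} (ha : a ∈ S) : a = 0 := by
  classical
  have key : ∀ n : ℕ, ∀ m : σ →₀ ℕ, m.degree = n → ∀ a ∈ S, coeff m a = 0 := by
    intro n
    induction n with
    | zero =>
      intro m hm a ha
      rw [degree_eq_zero_iff] at hm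
      subst hm
      exact h0 a ha
    | succ n ih =>
      intro m hm a ha
      have hne : m ≠ 0 := by rintro rfl; simp at hm
      obtain ⟨i, hi⟩ := Finsupp.ne_iff.mp hne
      have hsplit : m - single i 1 + single i 1 = m := by
        apply tsub_add_cancel_of_le
        simpa [single_le_iff, Nat.one_le_iff_ne_zero] using hi
      have hdeg : (m - single i 1).degree = n := by
        have := congrArg degree hsplit
        rw [map_add, hm] at this
        simpa using this
      -- The coefficient of `∂_i a` at `m - e_i` is that of `a` at `m` times a positive integer,
      -- invertible in characteristic zero.
      have h1 := ih _ hdeg _ (hS a ha i)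
      rw [coeff_pderiv, hsplit] at h1
      rcases mul_eq_zero.mp h1 with h | h
      · exact h
      · exact absurd h (Nat.cast_add_one_ne_zero _)
  ext m
  simpa using key _ m rfl a ha

/-- The derivation `D`, corrected by the derivations `∂/∂Z̄_j` so as to annihilate `ρ` when `S` is
a right inverse of `(∂ρ_k/∂Z̄_j)`. -/
noncomputable def tangentialPart (ρ : Fin d → MvPowerSeries (Fin N ⊕ Fin N) ℂ)
    (S : Matrix (Fin N) (Fin d) (MvPowerSeries (Fin N ⊕ Fin N) ℂ))
    (D : Derivation ℂ (MvPowerSeries (Fin N ⊕ Fin N) ℂ) (MvPowerSeries (Fin N ⊕ Fin N) ℂ)) :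
    Derivation ℂ (MvPowerSeries (Fin N ⊕ Fin N) ℂ) (MvPowerSeries (Fin N ⊕ Fin N) ℂ) :=
  D - ∑ j, (∑ k, S j k * D (ρ k)) • pderiv ℂ (Sum.inr j)

theorem tangentialPart_apply (ρ : Fin d → MvPowerSeries (Fin N ⊕ Fin N) ℂ)
    (S : Matrix (Fin N) (Fin d) (MvPowerSeries (Fin N ⊕ Fin N) ℂ))
    (D : Derivation ℂ (MvPowerSeries (Fin N ⊕ Fin N) ℂ) (MvPowerSeries (Fin N ⊕ Fin N) ℂ))
    (f : MvPowerSeries (Fin N ⊕ Fin N) ℂ) :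
    tangentialPart ρ S D f =
      D f - ∑ j, (∑ k, S j k * D (ρ k)) * pderiv ℂ (Sum.inr j) f := by
  simp only [tangentialPart, Derivation.sub_apply, ← Derivation.coeFnAddMonoidHom_apply]
  rw [map_sum]
  simp [Finset.sum_apply]

/-- The correction differentiates only in `Z̄`, so holomorphic series do not see it. -/
theorem tangentialPart_apply_rename (ρ : Fin d → MvPowerSeries (Fin N ⊕ Fin N) ℂ)
    (S : Matrix (Fin N) (Fin d) (MvPowerSeries (Fin N ⊕ Fin N) ℂ))
    (D : Derivation ℂ (MvPowerSeries (Fin N ⊕ Fin N) ℂ) (MvPowerSeries (Fin N ⊕ Fin N) ℂ))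
    (a : MvPowerSeries (Fin N) ℂ) :
    tangentialPart ρ S D (rename Sum.inl a) = D (rename Sum.inl a) := by
  simp [tangentialPart_apply, pderiv_inr_rename_inl]

theorem tangentialPart_apply_self {ρ : Fin d → MvPowerSeries (Fin N ⊕ Fin N) ℂ}
    {S : Matrix (Fin N) (Fin d) (MvPowerSeries (Fin N ⊕ Fin N) ℂ)}
    (hS : (Matrix.of fun k j => pderiv ℂ (Sum.inr j) (ρ k)) * S = 1)
    (D : Derivation ℂ (MvPowerSeries (Fin N ⊕ Fin N) ℂ) (MvPowerSeries (Fin N ⊕ Fin N) ℂ))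
    (k : Fin d) : tangentialPart ρ S D (ρ k) = 0 := by
  rw [tangentialPart_apply, sub_eq_zero]
  have h1 : ∀ l, ∑ j, pderiv ℂ (Sum.inr j) (ρ k) * S j l = if k = l then 1 else 0 := fun l => by
    have := congrFun (congrFun hS k) l
    simpa [Matrix.mul_apply, Matrix.one_apply] using this
  calc D (ρ k) = ∑ l, (if k = l then 1 else 0) * D (ρ l) := by simp
    _ = ∑ l, ∑ j, S j l * D (ρ l) * pderiv ℂ (Sum.inr j) (ρ k) := by
      refine Finset.sum_congr rfl fun l _ => ?_
      rw [← h1, Finset.sum_mul]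
      exact Finset.sum_congr rfl fun j _ => by ring
    _ = _ := by
      rw [Finset.sum_comm]
      exact Finset.sum_congr rfl fun j _ => by rw [Finset.sum_mul]

/-- By the Leibniz rule, killing the generators is enough to preserve the ideal. This is the formal
version of a tangent field differentiating functions on `M`. -/
theorem derivation_mem_span {A : Type*} [CommRing A] [Algebra ℂ A] {ι : Type*} {ρ : ι → A}
    (D : Derivation ℂ A A) (hD : ∀ k, D (ρ k) = 0) {f : A}
    (hf : f ∈ Ideal.span (Set.range ρ)) : D f ∈ Ideal.span (Set.range ρ) := by
  induction hf using Submodule.span_induction with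
  | mem x hx => obtain ⟨k, rfl⟩ := hx; simp [hD]
  | zero => simp
  | add x y _ _ hx hy => rw [map_add]; exact add_mem hx hy
  | smul a x hx hx' =>
    rw [smul_eq_mul, Derivation.leibniz]
    exact add_mem (Ideal.mul_mem_left _ _ hx') (Ideal.mul_mem_right _ _ hx)

/-- A formal generic submanifold contains no formal complex hypersurface: a holomorphic power
series in the ideal generated by `ρ` is zero. -/
theorem eq_zero_of_rename_mem_span {ρ : Fin d → MvPowerSeries (Fin N ⊕ Fin N) ℂ}
    (h0 : ∀ k, constantCoeff (ρ k) = 0)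
    {S : Matrix (Fin N) (Fin d) (MvPowerSeries (Fin N ⊕ Fin N) ℂ)}
    (hS : (Matrix.of fun k j => pderiv ℂ (Sum.inr j) (ρ k)) * S = 1)
    {a : MvPowerSeries (Fin N) ℂ} (ha : rename Sum.inl a ∈ Ideal.span (Set.range ρ)) : a = 0 := by
  have hmax : Ideal.span (Set.range ρ) ≤
      RingHom.ker (constantCoeff (σ := Fin N ⊕ Fin N) (R := ℂ)) := by
    rw [Ideal.span_le]
    rintro _ ⟨k, rfl⟩
    exact h0 k
  refine eq_zero_of_forall_pderiv
    {a : MvPowerSeries (Fin N) ℂ | rename Sum.inl a ∈ Ideal.span (Set.range ρ)} ?_ ?_ ha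
  · intro a ha
    have := hmax ha
    rwa [RingHom.mem_ker, constantCoeff_rename] at this
  · intro a ha i
    have := derivation_mem_span (tangentialPart ρ S (pderiv ℂ (Sum.inl i)))
      (tangentialPart_apply_self hS _) ha
    rwa [tangentialPart_apply_rename, pderiv_rename_inl] at this

/-- If the constant terms of the rows `b` with `∑ b_j a_j ∈ I` have no common annihilator, then
all `a_j` are in `I`. -/
theorem forall_mem_of_constantCoeff_rows {σ : Type*} {n : ℕ} (I : Ideal (MvPowerSeries σ ℂ))
    (a : Fin n → MvPowerSeries σ ℂ)
    (h : ∀ v : Fin n → ℂ, (∀ b : Fin n → MvPowerSeries σ ℂ, ∑ j, b j * a j ∈ I →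
      ∑ j, v j * constantCoeff (b j) = 0) → v = 0) (j : Fin n) : a j ∈ I := by
  -- `W` collects the constant terms of all admissible rows; the hypothesis says that its
  -- annihilator is trivial, so `W` is everything.
  let W : Submodule ℂ (Fin n → ℂ) :=
    { carrier := {x | ∃ b : Fin n → MvPowerSeries σ ℂ,
        ∑ j, b j * a j ∈ I ∧ x = fun j => constantCoeff (b j)}
      zero_mem' := ⟨0, by simp, by ext; simp⟩
      add_mem' := by
        rintro _ _ ⟨b, hb, rfl⟩ ⟨c, hc, rfl⟩
        exact ⟨b + c, by simpa [add_mul, Finset.sum_add_distrib] using add_mem hb hc,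
          by ext; simp⟩
      smul_mem' := by
        rintro r _ ⟨b, hb, rfl⟩
        exact ⟨fun j => C r * b j, by
          simpa [mul_assoc, ← Finset.mul_sum] using I.mul_mem_left (C r) hb, by ext; simp⟩ }
  have hW : W = ⊤ := by
    by_contra hne
    obtain ⟨f, hf0, hf⟩ := Submodule.exists_le_ker_of_lt_top W (lt_top_iff_ne_top.mpr hne)
    refine hf0 ?_
    have hfx : ∀ x, f x = ∑ j, f (Pi.single j 1) * x j := fun x => by
      rw [LinearMap.pi_apply_eq_sum_univ f x]
      refine Finset.sum_congr rfl fun j _ => ?_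
      rw [smul_eq_mul, mul_comm]
      congr 2
      ext i
      simp [Pi.single_apply, eq_comm]
    have hv := h (fun j => f (Pi.single j 1)) fun b hb => by
      have : (fun j => constantCoeff (b j)) ∈ W := ⟨b, hb, rfl⟩
      have := hf this
      rw [LinearMap.mem_ker, hfx] at this
      exact this
    ext j
    simpa using congrFun hv j
  have hrow : ∀ i, ∃ b : Fin n → MvPowerSeries σ ℂ,
      ∑ j, b j * a j ∈ I ∧ (Pi.single i 1 : Fin n → ℂ) = fun j => constantCoeff (b j) := fun i => by
    have : (Pi.single i 1 : Fin n → ℂ) ∈ W := hW ▸ Submodule.mem_top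
    exact this
  -- Rows with constant terms the standard basis form an invertible matrix `b`, and `a = b⁻¹ (b a)`
  -- with `b a` in `I`.
  choose b hbI hb0 using hrow
  have hdet : IsUnit (Matrix.of b).det := by
    rw [MvPowerSeries.isUnit_iff_constantCoeff, RingHom.map_det]
    have : (constantCoeff (σ := σ) (R := ℂ)).mapMatrix (Matrix.of b) = 1 := by
      ext i k
      have := congrFun (hb0 i) k
      simp only [RingHom.mapMatrix_apply, Matrix.map_apply, Matrix.of_apply, ← this,
        Matrix.one_apply, Pi.single_apply, eq_comm]
    rw [this]; simp
  have h1 : (Matrix.of b)⁻¹.mulVec ((Matrix.of b).mulVec a) = a := by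
    rw [Matrix.mulVec_mulVec, Matrix.nonsing_inv_mul _ hdet, Matrix.one_mulVec]
  rw [← h1, Matrix.mulVec, dotProduct]
  exact I.sum_mem fun k _ => I.mul_mem_left _ (hbI k)

/-- A formal generic submanifold that is 1-nondegenerate carries no nontrivial formal holomorphic
vector field. -/
theorem FormalHolVectorField.eq_zero_of_act_eq {ρ : Fin d → MvPowerSeries (Fin N ⊕ Fin N) ℂ}
    (h0 : ∀ k, constantCoeff (ρ k) = 0)
    (hgen : LinearIndependent ℂ (fun k j => coeff (single (Sum.inr j) 1) (ρ k)))
    (hnd : ∀ v : Fin N → ℂ, (∀ k, ∑ j, v j * coeff (single (Sum.inl j) 1) (ρ k) = 0) →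
      (∀ w : Fin N → ℂ, (∀ k, ∑ l, w l * coeff (single (Sum.inr l) 1) (ρ k) = 0) →
        ∀ k, ∑ j, ∑ l, v j * w l *
          coeff (single (Sum.inl j) 1 + single (Sum.inr l) 1) (ρ k) = 0) → v = 0)
    (X : FormalHolVectorField N) (c : Fin d → Fin d → MvPowerSeries (Fin N ⊕ Fin N) ℂ)
    (hX : ∀ k, X.act (ρ k) = ∑ l, c k l * ρ l) : X = 0 := by
  obtain ⟨S, hS⟩ := exists_right_inverse_of_constantCoeff
    (Matrix.of fun (k : Fin d) (j : Fin N) => pderiv ℂ (Sum.inr j) (ρ k))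
    (by simpa [constantCoeff_pderiv] using hgen)
  set I := Ideal.span (Set.range ρ) with hI
  have hρI : ∀ k, ρ k ∈ I := fun k => Ideal.subset_span ⟨k, rfl⟩
  have hrow : ∀ k, ∑ j, pderiv ℂ (Sum.inl j) (ρ k) * rename Sum.inl (X j) ∈ I := fun k => by
    have h1 : X.act (ρ k) ∈ I := by
      rw [hX]; exact I.sum_mem fun l _ => I.mul_mem_left _ (hρI l)
    simpa only [FormalHolVectorField.act, mul_comm] using h1
  have hmem := forall_mem_of_constantCoeff_rows I (fun j => rename Sum.inl (X j)) ?_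
  · funext j
    exact eq_zero_of_rename_mem_span h0 hS (hmem j)
  intro v hv
  refine hnd v (fun k => ?_) fun w hw k => ?_
  · simpa [constantCoeff_pderiv] using hv _ (hrow k)
  · set D₀ : Derivation ℂ (MvPowerSeries (Fin N ⊕ Fin N) ℂ) (MvPowerSeries (Fin N ⊕ Fin N) ℂ) :=
      ∑ l, w l • pderiv ℂ (Sum.inr l) with hD₀
    have hD₀a : ∀ f, D₀ f = ∑ l, w l • pderiv ℂ (Sum.inr l) f := fun f => by
      simp only [hD₀, ← Derivation.coeFnAddMonoidHom_apply]
      rw [map_sum]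
      simp [Finset.sum_apply]
    have hD₀r : ∀ l, constantCoeff (D₀ (ρ l)) = 0 := fun l => by
      simpa [hD₀a, constantCoeff_pderiv, smul_eq_C_mul] using hw l
    -- `D` is a formal (0,1) field tangent to `M`: it preserves `I` and kills the holomorphic
    -- coefficients of `X`, so only the entries of the row get differentiated.
    set D := tangentialPart ρ S D₀
    have h1 := derivation_mem_span D (tangentialPart_apply_self hS _) (hrow k)
    have h2 : ∀ j, D (rename Sum.inl (X j)) = 0 := fun j => by
      rw [tangentialPart_apply_rename, hD₀a]
      simp [pderiv_inr_rename_inl]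
    have h3 : ∑ j, D (pderiv ℂ (Sum.inl j) (ρ k)) * rename Sum.inl (X j) ∈ I := by
      rw [map_sum] at h1
      simpa only [Derivation.leibniz, h2, smul_eq_mul, mul_zero, zero_add,
      mul_comm (rename _ _)] using h1
    have h4 := hv _ h3
    -- Since `w` is tangent at the base point, the correction coefficients have no constant term
    -- (`hD₀r`); only mixed second derivatives survive.
    have h5 : ∀ j, constantCoeff (D (pderiv ℂ (Sum.inl j) (ρ k))) =
        ∑ l, w l * coeff (single (Sum.inl j) 1 + single (Sum.inr l) 1) (ρ k) := fun j => by
      rw [tangentialPart_apply]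
      simp only [map_sub, map_sum, map_mul, hD₀r, mul_zero, Finset.sum_const_zero, zero_mul,
        sub_zero]
      simp only [hD₀a, map_sum, smul_eq_C_mul, map_mul, constantCoeff_C]
      exact Finset.sum_congr rfl fun l _ => by rw [constantCoeff_pderiv_pderiv (by simp)]
    simpa only [h5, Finset.mul_sum, mul_assoc] using h4

end Formal

end CRGeometry

namespace CRGeometry

/-! ### Smoothness of holomorphic functions of several variables. -/

section Osgood

open Metric MeasureTheory

variable {E : Type*} [NormedAddCommGroup E] [NormedSpace ℂ E]

/-- Cauchy's estimate for the Fréchet derivative. -/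
theorem norm_fderiv_apply_le {φ : E → ℂ} {U : Set E} {x : E} {R B : ℝ}
    (hφ : DifferentiableOn ℂ φ U) (hU : IsOpen U) (hR : 0 < R) (hball : closedBall x R ⊆ U)
    (hB : ∀ y ∈ closedBall x R, ‖φ y‖ ≤ B) {v : E} (hv : ‖v‖ ≤ 1) : ‖fderiv ℂ φ x v‖ ≤ B / R := by
  have hmem : ∀ ζ ∈ closedBall (0 : ℂ) R, x + ζ • v ∈ closedBall x R := fun ζ hζ => by
    rw [mem_closedBall, dist_eq_norm, add_sub_cancel_left, norm_smul]
    have : ‖ζ‖ ≤ R := by simpa using hζ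
    nlinarith [norm_nonneg ζ, norm_nonneg v]
  have hline : ∀ ζ : ℂ, HasDerivAt (fun ζ : ℂ => x + ζ • v) v ζ := fun ζ => by
    simpa using ((hasDerivAt_id ζ).smul_const v).const_add x
  have hd : ∀ ζ ∈ closedBall (0 : ℂ) R,
      HasDerivAt (fun ζ : ℂ => φ (x + ζ • v)) (fderiv ℂ φ (x + ζ • v) v) ζ := fun ζ hζ =>
    ((hφ.differentiableAt (hU.mem_nhds (hball (hmem ζ hζ)))).hasFDerivAt.comp_hasDerivAt ζ
      (hline ζ))
  have h0 := (hd 0 (by simp [hR.le])).deriv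
  simp only [zero_smul, add_zero] at h0
  rw [← h0]
  refine Complex.norm_deriv_le_of_forall_mem_sphere_norm_le hR ?_ fun ζ hζ =>
    hB _ (hmem ζ (sphere_subset_closedBall hζ))
  refine DifferentiableOn.diffContOnCl_ball (U := closedBall 0 R) ?_ subset_rfl
  exact fun ζ hζ => (hd ζ hζ).differentiableAt.differentiableWithinAt

theorem norm_fderiv_le {φ : E → ℂ} {U : Set E} {x : E} {R B : ℝ}
    (hφ : DifferentiableOn ℂ φ U) (hU : IsOpen U) (hR : 0 < R) (hball : closedBall x R ⊆ U)
    (hB : ∀ y ∈ closedBall x R, ‖φ y‖ ≤ B) : ‖fderiv ℂ φ x‖ ≤ B / R := by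
  have hB0 : 0 ≤ B := (norm_nonneg _).trans (hB x (mem_closedBall_self hR.le))
  exact ContinuousLinearMap.opNorm_le_of_unit_norm (by positivity) fun v hv =>
    norm_fderiv_apply_le hφ hU hR hball hB hv.le

variable [FiniteDimensional ℂ E]

/-- The derivatives of a holomorphic function of several variables are holomorphic. -/
theorem differentiableOn_fderiv_apply {φ : E → ℂ} {U : Set E} (hφ : DifferentiableOn ℂ φ U)
    (hU : IsOpen U) (v : E) : DifferentiableOn ℂ (fun x => fderiv ℂ φ x v) U := by
  have := FiniteDimensional.proper ℂ E
  wlog hv : ‖v‖ ≤ 1 generalizing v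
  · have hv' : (‖v‖ : ℂ) ≠ 0 := by
      have : ‖v‖ ≠ 0 := by linarith
      exact_mod_cast this
    have h1 := (this ((‖v‖ : ℂ)⁻¹ • v) (by rw [norm_smul]; simpa using inv_mul_le_one)).const_smul
      (‖v‖ : ℂ)
    refine h1.congr fun x _ => ?_
    simp only [Pi.smul_apply, map_smul, smul_smul, mul_inv_cancel₀ hv', one_smul]
  intro x₀ hx₀
  obtain ⟨r, hr, hrU⟩ := nhds_basis_closedBall.mem_iff.mp (hU.mem_nhds hx₀)
  -- Three radii must fit in `r`: moving `x`, moving along `v` on the circle, and the ball for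
  -- Cauchy's estimate at the resulting point.
  set R := r / 3 with hRdef
  have hR : 0 < R := by positivity
  obtain ⟨B, hB⟩ := (isCompact_closedBall x₀ r).exists_bound_of_continuousOn
    (hφ.continuousOn.mono hrU)
  set c := circleMap 0 R with hc
  have hcn : ∀ θ, ‖c θ‖ = R := fun θ => by simp [hc, abs_of_pos hR]
  have hc0 : ∀ θ, c θ ≠ 0 := fun θ => by rw [← norm_pos_iff, hcn]; exact hR
  have hcc : Continuous c := continuous_circleMap 0 R
  set K : ℝ → ℂ := fun θ => (2 * Real.pi * Complex.I)⁻¹ * (c θ * Complex.I * (1 / c θ ^ 2)) with hK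
  have hKc : Continuous K := by
    refine continuous_const.mul ((hcc.mul continuous_const).mul ?_)
    exact continuous_const.div (hcc.pow 2) fun θ => pow_ne_zero 2 (hc0 θ)
  have hcv : ∀ ζ : ℂ, ‖ζ‖ ≤ R → ∀ x ∈ ball x₀ R, closedBall (x + ζ • v) R ⊆ closedBall x₀ r := by
    intro ζ hζ x hx
    refine closedBall_subset_closedBall' ?_
    rw [dist_eq_norm, show x + ζ • v - x₀ = (x - x₀) + ζ • v by abel]
    have h1 := norm_add_le (x - x₀) (ζ • v)
    rw [norm_smul] at h1
    have h2 : ‖x - x₀‖ < R := by simpa [dist_eq_norm] using hx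
    nlinarith [norm_nonneg ζ, norm_nonneg v]
  have hmem : ∀ ζ : ℂ, ‖ζ‖ ≤ R → ∀ x ∈ ball x₀ R, x + ζ • v ∈ U := fun ζ hζ x hx =>
    hrU (hcv ζ hζ x hx (mem_closedBall_self hR.le))
  -- One-variable Cauchy formula on the line through `x` in direction `v`. The right side involves
  -- only values of `φ`, so it can be differentiated in `x` under the integral.
  have hcauchy : ∀ x ∈ ball x₀ R, fderiv ℂ φ x v =
      ∫ θ in (0 : ℝ)..2 * Real.pi, K θ • φ (x + c θ • v) := fun x hx => by
    have hd : ∀ ζ ∈ closedBall (0 : ℂ) R,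
        HasDerivAt (fun ζ : ℂ => φ (x + ζ • v)) (fderiv ℂ φ (x + ζ • v) v) ζ := fun ζ hζ => by
      have h1 : HasDerivAt (fun ζ : ℂ => x + ζ • v) v ζ := by
        simpa using ((hasDerivAt_id ζ).smul_const v).const_add x
      exact (hφ.differentiableAt (hU.mem_nhds
        (hmem ζ (by simpa using hζ) x hx))).hasFDerivAt.comp_hasDerivAt ζ h1
    have h0 := (hd 0 (by simp [hR.le])).deriv
    simp only [zero_smul, add_zero] at h0
    have h1 : DifferentiableOn ℂ (fun ζ : ℂ => φ (x + ζ • v)) (closedBall 0 R) := fun ζ hζ =>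
      (hd ζ hζ).differentiableAt.differentiableWithinAt
    have h2 := h1.deriv_eq_smul_circleIntegral hR
    rw [h0, circleIntegral] at h2
    rw [← inv_smul_smul₀ Complex.two_pi_I_ne_zero (fderiv ℂ φ x v), ← h2,
      ← intervalIntegral.integral_smul]
    refine intervalIntegral.integral_congr fun θ _ => ?_
    have hdc : deriv c θ = c θ * Complex.I := deriv_circleMap 0 R θ
    simp only [hK, sub_zero, smul_smul, ← hc, mul_assoc, hdc]
  have hcont : ∀ x ∈ ball x₀ R, Continuous fun θ => φ (x + c θ • v) := fun x hx =>
    hφ.continuousOn.comp_continuous (by fun_prop) fun θ => hmem _ (hcn θ).le x hx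
  borelize E
  have : SecondCountableTopology E := secondCountable_of_proper
  have : ProperSpace (E →L[ℂ] ℂ) := FiniteDimensional.proper ℂ _
  have hder := intervalIntegral.hasFDerivAt_integral_of_dominated_of_fderiv_le
    (𝕜 := ℂ) (μ := volume) (a := 0) (b := 2 * Real.pi) (s := ball x₀ R)
    (F := fun x θ => K θ • φ (x + c θ • v)) (F' := fun x θ => K θ • fderiv ℂ φ (x + c θ • v))
    (bound := fun θ => ‖K θ‖ * (B / R)) (x₀ := x₀) (ball_mem_nhds x₀ hR) ?_ ?_ ?_ ?_ ?_ ?_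
  · refine (hder.differentiableAt.congr_of_eventuallyEq ?_).differentiableWithinAt
    filter_upwards [ball_mem_nhds x₀ hR] with x hx using hcauchy x hx
  · filter_upwards [ball_mem_nhds x₀ hR] with x hx
    exact (hKc.smul (hcont x hx)).aestronglyMeasurable
  · exact (hKc.smul (hcont x₀ (mem_ball_self hR))).intervalIntegrable _ _
  · refine hKc.aestronglyMeasurable.smul (Measurable.aestronglyMeasurable ?_)
    exact (measurable_fderiv ℂ φ).comp (by fun_prop : Continuous fun θ => x₀ + c θ • v).measurable
  · refine Filter.Eventually.of_forall fun θ _ x hx => ?_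
    rw [norm_smul]
    gcongr
    have hsub := hcv (c θ) (hcn θ).le x hx
    exact norm_fderiv_le hφ hU hR (hsub.trans hrU) fun y hy => hB y (hsub hy)
  · exact (hKc.norm.mul continuous_const).intervalIntegrable _ _
  · refine Filter.Eventually.of_forall fun θ _ x hx => ?_
    have h1 : HasFDerivAt (fun x => x + c θ • v) (ContinuousLinearMap.id ℂ E) x :=
      (hasFDerivAt_id x).add_const _
    have h2 := (hφ.differentiableAt (hU.mem_nhds
      (hmem _ (hcn θ).le x hx))).hasFDerivAt.comp x h1
    exact h2.const_smul (K θ)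

/-- Directional derivatives are again holomorphic, so induction on the order applies. -/
theorem contDiffOn_of_differentiableOn_complex {U : Set E} (hU : IsOpen U) (n : ℕ) :
    ∀ {φ : E → ℂ}, DifferentiableOn ℂ φ U → ContDiffOn ℂ n φ U := by
  induction n with
  | zero => exact fun hφ => contDiffOn_zero.mpr hφ.continuousOn
  | succ n ih =>
    intro φ hφ
    rw [Nat.cast_add, Nat.cast_one, contDiffOn_succ_iff_fderiv_of_isOpen hU]
    refine ⟨hφ, by simp, contDiffOn_clm_apply.mpr fun v => ih ?_⟩
    exact differentiableOn_fderiv_apply hφ hU v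

end Osgood

/-! ### Second-order limits along curves. -/

section SecondOrder

open Asymptotics Filter

variable {E : Type*} [NormedAddCommGroup E] [NormedSpace ℝ E]

/-- Second order Taylor expansion at a critical point, along a curve. -/
theorem tendsto_div_sq_of_hasDerivAt {f : E → ℝ} {x₀ u : E} (hf : ContDiffAt ℝ 2 f x₀)
    (hf' : fderiv ℝ f x₀ = 0) {γ : ℝ → E} (hγ : HasDerivAt γ u 0) (hγ0 : γ 0 = x₀) :
    Tendsto (fun t : ℝ => (f (γ t) - f x₀) / t ^ 2) (𝓝[≠] 0)
      (𝓝 (fderiv ℝ (fderiv ℝ f) x₀ u u / 2)) := by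
  set H := fderiv ℝ (fderiv ℝ f) x₀ with hH
  have hsymm : ∀ v w, H v w = H w v := fun v w =>
    (hf.isSymmSndFDerivAt (by simp)).eq v w
  have hdiff : DifferentiableAt ℝ (fderiv ℝ f) x₀ :=
    (hf.fderiv_right (m := 1) (by norm_num)).differentiableAt (by norm_num)
  set g : E → ℝ := fun x => f x - f x₀ - H (x - x₀) (x - x₀) / 2 with hg
  -- the remainder is `o(|x - x₀|²)`
  have hgo : g =o[𝓝 x₀] fun x => ‖x - x₀‖ ^ 2 := by
    have hdf : ∀ᶠ x in 𝓝 x₀, DifferentiableAt ℝ f x :=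
      (hf.eventually (by simp)).mono fun x hx => hx.differentiableAt (by norm_num)
    have hlo := hdiff.hasFDerivAt.isLittleO
    rw [hf'] at hlo
    rw [isLittleO_iff]
    intro ε hε
    obtain ⟨r, hr, hball⟩ := Metric.eventually_nhds_iff_ball.mp
      (hdf.and ((isLittleO_iff.mp hlo) hε))
    filter_upwards [Metric.ball_mem_nhds x₀ hr] with x hx
    have hsub : ∀ y ∈ segment ℝ x₀ x, y ∈ Metric.ball x₀ r ∧ ‖y - x₀‖ ≤ ‖x - x₀‖ := fun y hy => by
      have h1 := norm_sub_le_of_mem_segment hy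
      refine ⟨?_, h1⟩
      rw [mem_ball_iff_norm] at hx ⊢
      exact h1.trans_lt hx
    have hgd : ∀ y ∈ segment ℝ x₀ x, HasFDerivWithinAt g (fderiv ℝ f y - H (y - x₀))
        (segment ℝ x₀ x) y := fun y hy => by
      have h1 := (hball y (hsub y hy).1).1.hasFDerivAt
      have h2 : HasFDerivAt (fun y => y - x₀) (ContinuousLinearMap.id ℝ E) y :=
        (hasFDerivAt_id y).sub_const x₀
      have h3 : HasFDerivAt (fun y => H (y - x₀)) H y := by
        exact (H.hasFDerivAt.comp y h2).congr_fderiv (by ext; rfl)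
      have h4 := (h3.clm_apply h2).mul_const (2 : ℝ)⁻¹
      simp only [← div_eq_mul_inv] at h4
      refine (((h1.sub_const (f x₀)).sub h4).congr_fderiv ?_).hasFDerivWithinAt
      ext w
      simp only [_root_.smul_apply, _root_.sub_apply, _root_.add_apply, smul_eq_mul,
        ContinuousLinearMap.comp_apply, ContinuousLinearMap.id_apply,
        ContinuousLinearMap.flip_apply, hsymm w]
      ring
    -- The derivative of the remainder is at most `ε ‖x - x₀‖` on the whole segment; the mean value
    -- inequality supplies the second factor `‖x - x₀‖`.
    have h := (convex_segment x₀ x).norm_image_sub_le_of_norm_hasFDerivWithin_le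
      (C := ε * ‖x - x₀‖) hgd (fun y hy => ?_) (left_mem_segment ℝ x₀ x)
      (right_mem_segment ℝ x₀ x)
    · have h0 : g x₀ = 0 := by simp [hg]
      rw [h0, sub_zero] at h
      rw [norm_pow, norm_norm, sq, ← mul_assoc]
      exact h
    · have h1 := (hball y (hsub y hy).1).2
      rw [sub_zero] at h1
      exact h1.trans (by gcongr; exact (hsub y hy).2)
  have hslope : Tendsto (fun t : ℝ => t⁻¹ • (γ t - x₀)) (𝓝[≠] 0) (𝓝 u) := by
    have := hγ.tendsto_slope_zero
    simpa [hγ0] using this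
  have hcont : Tendsto γ (𝓝[≠] 0) (𝓝 x₀) := by
    have := hγ.continuousAt.tendsto
    rw [hγ0] at this
    exact this.mono_left nhdsWithin_le_nhds
  have hO : (fun t => ‖γ t - x₀‖ ^ 2) =O[𝓝[≠] 0] fun t : ℝ => t ^ 2 := by
    have : (fun t => γ t - x₀) =O[𝓝[≠] 0] fun t : ℝ => t := by
      have := hγ.hasFDerivAt.isBigO_sub
      simp only [hγ0, sub_zero] at this
      exact this.mono nhdsWithin_le_nhds
    exact this.norm_left.pow 2
  have h1 : Tendsto (fun t => g (γ t) / t ^ 2) (𝓝[≠] 0) (𝓝 0) :=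
    ((hgo.comp_tendsto hcont).trans_isBigO hO).tendsto_div_nhds_zero
  have h2 : Tendsto (fun t : ℝ => H (t⁻¹ • (γ t - x₀)) (t⁻¹ • (γ t - x₀)) / 2) (𝓝[≠] 0)
      (𝓝 (H u u / 2)) := by
    have hc : Continuous fun y => H y y / 2 := by fun_prop
    exact (hc.tendsto u).comp hslope
  have h3 := h1.add h2
  rw [zero_add] at h3
  refine h3.congr' ?_
  filter_upwards [self_mem_nhdsWithin] with t ht
  have ht : t ≠ 0 := ht
  simp only [hg, map_smul, _root_.smul_apply, smul_eq_mul]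
  field_simp
  ring

end SecondOrder

/-! ### Curves in a level set with prescribed velocity. -/

section Curves

variable {E F : Type*} [NormedAddCommGroup E] [NormedSpace ℝ E] [CompleteSpace E]
  [NormedAddCommGroup F] [NormedSpace ℝ F] [FiniteDimensional ℝ F]

/-- Every vector in the kernel of a surjective derivative is tangent to a curve in the fibre. -/
theorem exists_curve_of_mem_ker {f : E → F} {f' : E →L[ℝ] F} {p : E} (hf : HasStrictFDerivAt f f' p)
    (hsurj : f'.range = ⊤) {u : E} (hu : f' u = 0) :
    ∃ γ : ℝ → E, γ 0 = p ∧ HasDerivAt γ u 0 ∧ ∀ᶠ t in 𝓝 0, f (γ t) = f p := by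
  let y : f'.ker := ⟨u, hu⟩
  have hline : HasDerivAt (fun t : ℝ => t • y) y 0 := by
    simpa using (hasDerivAt_id (0 : ℝ)).smul_const y
  refine ⟨fun t => hf.implicitFunction f f' hsurj (f p) (t • y), by simp, ?_, ?_⟩
  · have h1 : HasFDerivAt (hf.implicitFunction f f' hsurj (f p)) f'.ker.subtypeL
        ((0 : ℝ) • y) := by
      rw [zero_smul]; exact (hf.to_implicitFunction hsurj).hasFDerivAt
    exact h1.comp_hasDerivAt (0 : ℝ) hline
  · have h1 := hf.map_implicitFunction_eq hsurj
    have h2 : Filter.Tendsto (fun t : ℝ => (f p, t • y)) (𝓝 0) (𝓝 (f p, 0)) := by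
      have := (continuousAt_const (y := f p)).prodMk hline.continuousAt
      simpa [ContinuousAt] using this
    exact h2.eventually h1

end Curves

end CRGeometry

namespace CRGeometry

/-! ### The Taylor coefficients that enter: constant, first order, and mixed second order. -/

section TaylorCoefficients

open Finsupp

variable {N : ℕ}

theorem foldr_iterate_eq_self {D : Fin N → ((Fin N → ℂ) → ℂ) → ((Fin N → ℂ) → ℂ)} {α : Fin N → ℕ}
    (f : (Fin N → ℂ) → ℂ) : ∀ l : List (Fin N), (∀ i ∈ l, α i = 0) →
      l.foldr (fun j g => (D j)^[α j] g) f = f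
  | [], _ => rfl
  | i :: l, h => by
    rw [List.foldr_cons, foldr_iterate_eq_self f l fun j hj => h j (List.mem_cons_of_mem _ hj),
      h i List.mem_cons_self, Function.iterate_zero_apply]

theorem iterD_zero (D : Fin N → ((Fin N → ℂ) → ℂ) → ((Fin N → ℂ) → ℂ)) (f : (Fin N → ℂ) → ℂ) :
    iterD D (fun _ => 0) f = f :=
  foldr_iterate_eq_self f _ fun _ _ => rfl

theorem foldr_iterate_single {D : Fin N → ((Fin N → ℂ) → ℂ) → ((Fin N → ℂ) → ℂ)} {α : Fin N → ℕ}
    (f : (Fin N → ℂ) → ℂ) {j : Fin N} (hj : α j = 1) : ∀ l : List (Fin N), l.Nodup → j ∈ l →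
      (∀ i ∈ l, i ≠ j → α i = 0) → l.foldr (fun j g => (D j)^[α j] g) f = D j f
  | [], _, hjl, _ => absurd hjl List.not_mem_nil
  | i :: l, hl, hjl, h => by
    rw [List.nodup_cons] at hl
    rw [List.foldr_cons]
    rcases eq_or_ne i j with rfl | hij
    · rw [foldr_iterate_eq_self f l fun k hk => h k (List.mem_cons_of_mem _ hk)
        fun hki => hl.1 (hki ▸ hk), hj, Function.iterate_one]
    · rw [foldr_iterate_single f hj l hl.2 (List.mem_of_ne_of_mem hij.symm hjl)
        fun k hk => h k (List.mem_cons_of_mem _ hk), h i List.mem_cons_self hij,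
        Function.iterate_zero_apply]

theorem iterD_single (D : Fin N → ((Fin N → ℂ) → ℂ) → ((Fin N → ℂ) → ℂ)) (f : (Fin N → ℂ) → ℂ)
    {α : Fin N → ℕ} {j : Fin N} (hj : α j = 1) (h : ∀ i, i ≠ j → α i = 0) :
    iterD D α f = D j f :=
  foldr_iterate_single f hj _ (List.nodup_finRange N) (List.mem_finRange j) fun i _ => h i

theorem constantCoeff_taylorSeries (f : (Fin N → ℂ) → ℂ) (p : Fin N → ℂ) :
    MvPowerSeries.constantCoeff (taylorSeries f p) = f p := by
  change taylorSeries f p 0 = f p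
  simp [taylorSeries, iterD_zero]

theorem prod_factorial_eq_one {σ : Type*} [Fintype σ] {m : σ →₀ ℕ} (hm : ∀ s, m s ≤ 1) :
    ∏ s, (m s).factorial = 1 :=
  Finset.prod_eq_one fun s _ => Nat.factorial_eq_one.mpr (hm s)

theorem coeff_inl_taylorSeries (f : (Fin N → ℂ) → ℂ) (p : Fin N → ℂ) (j : Fin N) :
    MvPowerSeries.coeff (single (Sum.inl j) 1) (taylorSeries f p) = dZ j f p := by
  classical
  change taylorSeries f p (single (Sum.inl j) 1) = dZ j f p
  rw [taylorSeries, prod_factorial_eq_one fun s => by rw [single_apply]; split_ifs <;> simp,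
    iterD_single dZ _ (j := j) (by simp) fun i hi => by simp [hi.symm]]
  simp [iterD_zero]

theorem coeff_inr_taylorSeries (f : (Fin N → ℂ) → ℂ) (p : Fin N → ℂ) (j : Fin N) :
    MvPowerSeries.coeff (single (Sum.inr j) 1) (taylorSeries f p) = dZbar j f p := by
  classical
  change taylorSeries f p (single (Sum.inr j) 1) = dZbar j f p
  rw [taylorSeries, prod_factorial_eq_one fun s => by rw [single_apply]; split_ifs <;> simp,
    iterD_single dZbar _ (j := j) (by simp) fun i hi => by simp [hi.symm]]
  simp [iterD_zero]

theorem coeff_inl_inr_taylorSeries (f : (Fin N → ℂ) → ℂ) (p : Fin N → ℂ) (j l : Fin N) :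
    MvPowerSeries.coeff (single (Sum.inl j) 1 + single (Sum.inr l) 1) (taylorSeries f p) =
      dZ j (dZbar l f) p := by
  classical
  change taylorSeries f p (single (Sum.inl j) 1 + single (Sum.inr l) 1) = _
  rw [taylorSeries, prod_factorial_eq_one, iterD_single dZ _ (j := j),
    iterD_single dZbar _ (j := l)]
  · simp
  · simp
  · intro i hi; simp [hi.symm]
  · simp
  · intro i hi; simp [hi.symm]
  · rintro (s | s) <;> simp only [Finsupp.add_apply, single_apply] <;> split_ifs <;> simp_all

end TaylorCoefficients

/-! ### Wirtinger derivatives in terms of real derivatives. -/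

section Wirtinger

variable {N : ℕ}

theorem single_I_eq (l : Fin N) :
    (Pi.single l Complex.I : Fin N → ℂ) = Complex.I • Pi.single l 1 := by
  ext i
  simp [Pi.single_apply]

/-- A real-linear map commuting with `i` is complex linear, hence determined by its values on the
standard basis. -/
theorem apply_eq_sum_of_map_I_smul (g : (Fin N → ℂ) →ₗ[ℝ] ℂ)
    (hg : ∀ v, g (Complex.I • v) = Complex.I * g v) (v : Fin N → ℂ) :
    g v = ∑ j, v j * g (Pi.single j 1) := by
  have hsmul : ∀ (c : ℂ) v, g (c • v) = c * g v := fun c v => by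
    have h1 : c • v = c.re • v + c.im • (Complex.I • v) := by
      ext i
      simp only [Pi.smul_apply, Pi.add_apply, smul_eq_mul, Complex.real_smul]
      conv_lhs => rw [← Complex.re_add_im c]
      ring
    rw [h1, map_add, map_smul, map_smul, hg]
    conv_rhs => rw [← Complex.re_add_im c]
    simp only [Complex.real_smul]
    ring
  conv_lhs => rw [← Finset.univ_sum_single v]
  rw [map_sum]
  refine Finset.sum_congr rfl fun j _ => ?_
  rw [← hsmul]
  congr 1
  ext i
  simp [Pi.single_apply]

theorem apply_eq_sum_of_map_I_smul_neg (g : (Fin N → ℂ) →ₗ[ℝ] ℂ)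
    (hg : ∀ v, g (Complex.I • v) = -(Complex.I * g v)) (v : Fin N → ℂ) :
    g v = ∑ j, star (v j) * g (Pi.single j 1) := by
  have h := apply_eq_sum_of_map_I_smul (Complex.conjLIE.toLinearEquiv.toLinearMap ∘ₗ g)
    (fun v => by simp [hg]) v
  simp only [LinearMap.comp_apply] at h
  have h2 := congrArg (starRingEnd ℂ) h
  simpa [map_sum] using h2

variable {d : ℕ}

theorem fderiv_ofReal_apply {ρ : (Fin N → ℂ) → Fin d → ℝ} {Z : Fin N → ℂ}
    (hρ : DifferentiableAt ℝ ρ Z) (k : Fin d) (v : Fin N → ℂ) :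
    fderiv ℝ (fun W => (ρ W k : ℂ)) Z v = (fderiv ℝ ρ Z v k : ℂ) := by
  have h1 := (hasFDerivAt_pi'.mp hρ.hasFDerivAt) k
  have h2 := Complex.ofRealCLM.hasFDerivAt.comp Z h1
  rw [show (fun W => (ρ W k : ℂ)) = Complex.ofRealCLM ∘ fun W => ρ W k from rfl, h2.fderiv]
  rfl

theorem sum_mul_dZ {ρ : (Fin N → ℂ) → Fin d → ℝ} {Z : Fin N → ℂ}
    (hρ : DifferentiableAt ℝ ρ Z) (k : Fin d) (v : Fin N → ℂ) :
    ∑ j, v j * dZ j (fun W => (ρ W k : ℂ)) Z =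
      1 / 2 * (fderiv ℝ ρ Z v k - Complex.I * fderiv ℝ ρ Z (Complex.I • v) k) := by
  let g : (Fin N → ℂ) →ₗ[ℝ] ℂ :=
    { toFun := fun v => 1 / 2 * (fderiv ℝ ρ Z v k - Complex.I * fderiv ℝ ρ Z (Complex.I • v) k)
      map_add' := fun x y => by simp; ring
      map_smul' := fun r x => by
        rw [smul_comm Complex.I r x]
        simp; ring }
  have hg := apply_eq_sum_of_map_I_smul g (fun v => by
    simp only [g, LinearMap.coe_mk, AddHom.coe_mk, smul_smul, Complex.I_mul_I, neg_smul, one_smul,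
      map_neg, Pi.neg_apply, Complex.ofReal_neg]
    linear_combination (fderiv ℝ ρ Z (Complex.I • v) k / 2 : ℂ) * Complex.I_mul_I) v
  refine Eq.trans ?_ hg.symm
  refine Finset.sum_congr rfl fun j _ => ?_
  simp only [g, LinearMap.coe_mk, AddHom.coe_mk, dZ, fderiv_ofReal_apply hρ,
    single_I_eq]

theorem dZbar_ofReal {ρ : (Fin N → ℂ) → Fin d → ℝ} {Z : Fin N → ℂ}
    (hρ : DifferentiableAt ℝ ρ Z) (k : Fin d) (j : Fin N) :
    dZbar j (fun W => (ρ W k : ℂ)) Z = star (dZ j (fun W => (ρ W k : ℂ)) Z) := by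
  simp [dZ, dZbar, fderiv_ofReal_apply hρ]

/-- The Levi form of a real-valued function in terms of the real Hessian. -/
theorem sum_mul_dZ_dZbar {ρ : (Fin N → ℂ) → Fin d → ℝ} {p : Fin N → ℂ}
    (hρ : ContDiffAt ℝ 2 ρ p) (k : Fin d) (v y : Fin N → ℂ) :
    ∑ j, ∑ l, v j * star (y l) * dZ j (dZbar l (fun W => (ρ W k : ℂ))) p =
      1 / 4 * ((fderiv ℝ (fderiv ℝ ρ) p v y k +
          fderiv ℝ (fderiv ℝ ρ) p (Complex.I • v) (Complex.I • y) k) +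
        Complex.I * (fderiv ℝ (fderiv ℝ ρ) p v (Complex.I • y) k -
          fderiv ℝ (fderiv ℝ ρ) p (Complex.I • v) y k)) := by
  set H := fderiv ℝ (fderiv ℝ ρ) p with hH
  have hdiff : HasFDerivAt (fderiv ℝ ρ) H p :=
    ((hρ.fderiv_right (m := 1) (by norm_num)).differentiableAt (by norm_num)).hasFDerivAt
  have hev : ∀ᶠ Z in 𝓝 p, DifferentiableAt ℝ ρ Z :=
    (hρ.eventually (by simp)).mono fun x hx => hx.differentiableAt (by norm_num)
  have hd : ∀ (x : Fin N → ℂ), HasFDerivAt (fun Z => (fderiv ℝ ρ Z x k : ℂ))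
      (Complex.ofRealCLM ∘L (ContinuousLinearMap.proj k ∘L H.flip x)) p := fun x => by
    have h1 := hdiff.clm_apply (hasFDerivAt_const x p)
    have h2 := ((ContinuousLinearMap.proj (R := ℝ) (φ := fun _ : Fin d => ℝ) k).hasFDerivAt).comp
      p h1
    have h3 := Complex.ofRealCLM.hasFDerivAt.comp p h2
    refine h3.congr_fderiv ?_
    ext w
    simp
  have hbar : ∀ l, HasFDerivAt (dZbar l (fun W => (ρ W k : ℂ))) ((1 / 2 : ℂ) •
      ((Complex.ofRealCLM ∘L (ContinuousLinearMap.proj k ∘L H.flip (Pi.single l 1))) + Complex.I •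
      (Complex.ofRealCLM ∘L (ContinuousLinearMap.proj k ∘L H.flip (Pi.single l Complex.I))))) p := by
    intro l
    refine (((hd (Pi.single l 1)).add ((hd (Pi.single l Complex.I)).const_smul
      Complex.I)).const_smul (1 / 2 : ℂ)).congr_of_eventuallyEq ?_
    filter_upwards [hev] with Z hZ
    simp [dZbar, fderiv_ofReal_apply hZ]
  -- `L` is complex linear in `v` and antilinear in `y`, so it suffices to compare it with the
  -- Wirtinger derivatives on basis vectors.
  let L : (Fin N → ℂ) → (Fin N → ℂ) → ℂ := fun v y =>
    1 / 4 * ((H v y k + H (Complex.I • v) (Complex.I • y) k) +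
      Complex.I * (H v (Complex.I • y) k - H (Complex.I • v) y k))
  have hterm : ∀ j l, dZ j (dZbar l (fun W => (ρ W k : ℂ))) p =
      L (Pi.single j 1) (Pi.single l 1) := fun j l => by
    rw [dZ, (hbar l).fderiv]
    simp only [single_I_eq, L, _root_.smul_apply, _root_.add_apply, ContinuousLinearMap.comp_apply,
      ContinuousLinearMap.flip_apply, ContinuousLinearMap.proj_apply, Complex.ofRealCLM_apply,
      smul_eq_mul]
    linear_combination (-(1 / 4 : ℂ) * H (Complex.I • Pi.single j 1)
      (Complex.I • Pi.single l 1) k) * Complex.I_mul_I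
  have hleft : ∀ y, L v y = ∑ j, v j * L (Pi.single j 1) y := fun y => by
    let g : (Fin N → ℂ) →ₗ[ℝ] ℂ :=
      { toFun := fun v => L v y
        map_add' := fun a b => by simp [L]; ring
        map_smul' := fun r a => by
          simp only [L, smul_comm Complex.I r a]
          simp; ring }
    refine apply_eq_sum_of_map_I_smul g (fun v => ?_) v
    simp only [g, LinearMap.coe_mk, AddHom.coe_mk, L, smul_smul, Complex.I_mul_I, neg_smul,
      one_smul, map_neg, Pi.neg_apply, Complex.ofReal_neg, _root_.neg_apply]
    linear_combination (-(1 / 4 : ℂ) * (H v (Complex.I • y) k - H (Complex.I • v) y k)) *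
      Complex.I_mul_I
  have hright : ∀ v, L v y = ∑ l, star (y l) * L v (Pi.single l 1) := fun v => by
    let g : (Fin N → ℂ) →ₗ[ℝ] ℂ :=
      { toFun := fun y => L v y
        map_add' := fun a b => by simp [L]; ring
        map_smul' := fun r a => by
          simp only [L, smul_comm Complex.I r a]
          simp; ring }
    refine apply_eq_sum_of_map_I_smul_neg g (fun y => ?_) y
    simp only [g, LinearMap.coe_mk, AddHom.coe_mk, L, smul_smul, Complex.I_mul_I, neg_smul,
      one_smul, map_neg, Pi.neg_apply, Complex.ofReal_neg]
    linear_combination ((1 / 4 : ℂ) * (H v (Complex.I • y) k - H (Complex.I • v) y k)) *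
      Complex.I_mul_I
  change _ = L v y
  rw [hleft]
  refine Finset.sum_congr rfl fun j _ => ?_
  rw [hright, Finset.mul_sum]
  exact Finset.sum_congr rfl fun l _ => by rw [hterm, mul_assoc]

/-- The differential of a generic defining function is onto. -/
theorem range_fderiv_eq_top {ρ : (Fin N → ℂ) → Fin d → ℝ} {p : Fin N → ℂ}
    (hρ : DifferentiableAt ℝ ρ p) (hgen : LinearIndependent ℂ
      (fun k : Fin d => fun j : Fin N => dZ j (fun W => (ρ W k : ℂ)) p)) :
    (fderiv ℝ ρ p).range = ⊤ := by
  by_contra hne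
  -- A functional killing the range is a real relation among the `dρ_k`, hence a relation among the
  -- `∂ρ_k`.
  obtain ⟨f, hf0, hf⟩ := Submodule.exists_le_ker_of_lt_top _ (lt_top_iff_ne_top.mpr hne)
  have hfx : ∀ x, f x = ∑ k, f (Pi.single k 1) * x k := fun x => by
    rw [LinearMap.pi_apply_eq_sum_univ f x]
    refine Finset.sum_congr rfl fun j _ => ?_
    rw [smul_eq_mul, mul_comm]
    congr 2
    ext i
    simp [Pi.single_apply, eq_comm]
  have h0 : ∀ v, ∑ k, (f (Pi.single k 1) : ℂ) * (fderiv ℝ ρ p v k : ℂ) = 0 := fun v => by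
    have h1 : f (fderiv ℝ ρ p v) = 0 := hf ⟨v, rfl⟩
    rw [hfx] at h1
    exact_mod_cast h1
  have hli := Fintype.linearIndependent_iff.mp hgen (fun k => (f (Pi.single k 1) : ℂ)) (by
    ext j
    simp only [Finset.sum_apply, Pi.smul_apply, smul_eq_mul, Pi.zero_apply, dZ,
      fderiv_ofReal_apply hρ]
    calc _ = 1 / 2 * (∑ k, (f (Pi.single k 1) : ℂ) * (fderiv ℝ ρ p (Pi.single j 1) k : ℂ) -
          Complex.I * ∑ k, (f (Pi.single k 1) : ℂ) *
            (fderiv ℝ ρ p (Pi.single j Complex.I) k : ℂ)) := by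
          rw [Finset.mul_sum, ← Finset.sum_sub_distrib, Finset.mul_sum]
          exact Finset.sum_congr rfl fun k _ => by ring
      _ = 0 := by rw [h0, h0]; simp)
  refine hf0 ?_
  ext k
  simpa using hli k

end Wirtinger

/-! ### Imaginary parts of holomorphic functions. -/

section Pluriharmonic

variable {E : Type*} [NormedAddCommGroup E] [NormedSpace ℂ E] [FiniteDimensional ℂ E]

theorem contDiffAt_im {φ : E → ℂ} {U : Set E} (hφ : DifferentiableOn ℂ φ U) (hU : IsOpen U) {p : E}
    (hp : p ∈ U) : ContDiffAt ℝ 2 (fun x => (φ x).im) p := by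
  have h1 := ((contDiffOn_of_differentiableOn_complex hU 2 hφ).contDiffAt
    (hU.mem_nhds hp)).restrict_scalars ℝ
  exact Complex.imCLM.contDiff.contDiffAt.comp p h1

/-- The imaginary part of a holomorphic function has vanishing Levi form. -/
theorem fderiv_fderiv_im_add {φ : E → ℂ} {U : Set E} (hφ : DifferentiableOn ℂ φ U) (hU : IsOpen U)
    {p : E} (hp : p ∈ U) (v w : E) :
    fderiv ℝ (fderiv ℝ fun x => (φ x).im) p v w +
      fderiv ℝ (fderiv ℝ fun x => (φ x).im) p (Complex.I • v) (Complex.I • w) = 0 := by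
  have hg : ContDiffAt ℝ 2 (fun x => (φ x).im) p := contDiffAt_im hφ hU hp
  have hdiff := ((hg.fderiv_right (m := 1) (by norm_num)).differentiableAt
    (by norm_num)).hasFDerivAt
  have hfd : ∀ x ∈ U, ∀ w, fderiv ℝ (fun x => (φ x).im) x w = (fderiv ℂ φ x w).im := by
    intro x hx w
    have h1 := (hφ.differentiableAt (hU.mem_nhds hx)).hasFDerivAt.restrictScalars ℝ
    have h2 := Complex.imCLM.hasFDerivAt.comp x h1
    rw [show (fun x => (φ x).im) = Complex.imCLM ∘ φ from rfl, h2.fderiv]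
    rfl
  -- The real Hessian is the imaginary part of a complex bilinear form, so applying `i` in both
  -- slots multiplies it by `i² = -1`.
  have key : ∀ v w, fderiv ℝ (fderiv ℝ fun x => (φ x).im) p v w =
      (fderiv ℂ (fun x => fderiv ℂ φ x w) p v).im := by
    intro v w
    have h1 := ((differentiableOn_fderiv_apply hφ hU w).differentiableAt
      (hU.mem_nhds hp)).hasFDerivAt.restrictScalars ℝ
    have h2 := Complex.imCLM.hasFDerivAt.comp p h1
    have h3 := hdiff.clm_apply (hasFDerivAt_const w p)
    have h4 : (fun x => fderiv ℝ (fun x => (φ x).im) x w) =ᶠ[𝓝 p]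
        Complex.imCLM ∘ fun x => fderiv ℂ φ x w := by
      filter_upwards [hU.mem_nhds hp] with x hx using hfd x hx w
    have h5 := h3.unique (h2.congr_of_eventuallyEq h4)
    have h6 := DFunLike.congr_fun h5 v
    simpa using h6
  have h7 : (fun x => fderiv ℂ φ x (Complex.I • w)) = fun x => Complex.I • fderiv ℂ φ x w := by
    ext x; simp
  have h8 := (differentiableOn_fderiv_apply hφ hU w).differentiableAt (hU.mem_nhds hp)
  rw [key, key, h7, fderiv_fun_const_smul h8]
  simp

end Pluriharmonic

end CRGeometry

namespace CRGeometry

/-! ### From the reduced equations to the Levi form of an arbitrary defining function. -/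

section Reduced

open Filter Asymptotics

variable {N n d : ℕ}

/-- The real quadratic form `Re (ᵗz̄ A z)`. -/
noncomputable def reQuad (A : Matrix (Fin n) (Fin n) ℂ) (z : Fin n → ℂ) : ℝ :=
  (star z ⬝ᵥ A.mulVec z).re

theorem reQuad_smul (A : Matrix (Fin n) (Fin n) ℂ) (t : ℝ) (z : Fin n → ℂ) :
    reQuad A (t • z) = t ^ 2 * reQuad A z := by
  simp only [reQuad, star_smul, Matrix.mulVec_smul, smul_dotProduct, dotProduct_smul]
  simp only [Complex.real_smul, star_trivial, Complex.re_ofReal_mul]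
  ring

theorem reQuad_I_smul (A : Matrix (Fin n) (Fin n) ℂ) (z : Fin n → ℂ) :
    reQuad A (Complex.I • z) = reQuad A z := by
  simp [reQuad, star_smul, Matrix.mulVec_smul, smul_dotProduct, dotProduct_smul, ← mul_assoc]

theorem continuous_reQuad (A : Matrix (Fin n) (Fin n) ℂ) : Continuous (reQuad A) :=
  Complex.continuous_re.comp (Continuous.dotProduct (by fun_prop)
    (Continuous.matrix_mulVec continuous_const continuous_id))

open scoped ComplexOrder in
/-- A Hermitian matrix maps the radical of its quadratic form to zero. -/
theorem mulVec_eq_zero_of_reQuad {A : Matrix (Fin n) (Fin n) ℂ} (hA : A.IsHermitian)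
    {a : Fin n → ℂ} (h : ∀ b, reQuad A (a + b) - reQuad A a - reQuad A b = 0) :
    A.mulVec a = 0 := by
  have h1 : ∀ b, star a ⬝ᵥ A.mulVec b = star (star b ⬝ᵥ A.mulVec a) := fun b => by
    rw [Matrix.star_dotProduct, Matrix.star_mulVec, hA.eq, Matrix.dotProduct_mulVec]
  -- For `b = A a` the polar form equals `2 ‖A a‖²` (Euclidean norm).
  have h2 := h (A.mulVec a)
  simp only [reQuad, star_add, Matrix.mulVec_add, add_dotProduct, dotProduct_add,
    Complex.add_re, h1 (A.mulVec a), Complex.star_def, Complex.conj_re] at h2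
  have h3 : (star (A.mulVec a) ⬝ᵥ A.mulVec a).re = 0 := by linarith
  have h4 : 0 ≤ star (A.mulVec a) ⬝ᵥ A.mulVec a := dotProduct_star_self_nonneg _
  exact dotProduct_star_self_eq_zero.mp (Complex.ext h3 (Complex.nonneg_iff.mp h4).2.symm)

theorem tendsto_reQuad_div_sq (A : Matrix (Fin n) (Fin n) ℂ) {Z : ℝ → Fin n → ℂ} {z : Fin n → ℂ}
    (hZ : HasDerivAt Z z 0) (hZ0 : Z 0 = 0) :
    Tendsto (fun t => reQuad A (Z t) / t ^ 2) (𝓝[≠] 0) (𝓝 (reQuad A z)) := by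
  have h1 : Tendsto (fun t : ℝ => t⁻¹ • Z t) (𝓝[≠] 0) (𝓝 z) := by
    simpa [hZ0] using hZ.tendsto_slope_zero
  refine (((continuous_reQuad A).tendsto z).comp h1).congr' ?_
  filter_upwards with t
  rw [Function.comp_apply, reQuad_smul, inv_pow, mul_comm, div_eq_mul_inv]

theorem tendsto_div_of_div_sq {f : ℝ → ℝ} {c : ℝ}
    (hf : Tendsto (fun t => f t / t ^ 2) (𝓝[≠] 0) (𝓝 c)) :
    Tendsto (fun t => f t / t) (𝓝[≠] 0) (𝓝 0) := by
  have h1 : Tendsto (fun t : ℝ => t) (𝓝[≠] 0) (𝓝 0) := tendsto_id.mono_left nhdsWithin_le_nhds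
  have h2 := hf.mul h1
  rw [mul_zero] at h2
  refine h2.congr' ?_
  filter_upwards [self_mem_nhdsWithin] with t ht
  have ht : t ≠ 0 := ht
  field_simp

/-- A negligible function vanishes to second order along curves tangent to `u = 0`. -/
theorem negligible_along_curve {h : (Fin n → ℂ) × (Fin d → ℝ) → Fin d → ℝ}
    (hs : ∃ V ∈ 𝓝 (0 : (Fin n → ℂ) × (Fin d → ℝ)), ContDiffOn ℝ ∞ h V)
    (hn : h =o[𝓝 0] (fun x : (Fin n → ℂ) × (Fin d → ℝ) => ‖x.1‖ ^ 2 + ‖x.2‖)) (k : Fin d)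
    {x : ℝ → (Fin n → ℂ) × (Fin d → ℝ)} {ξ : (Fin n → ℂ) × (Fin d → ℝ)} (hx : HasDerivAt x ξ 0)
    (hx0 : x 0 = 0) :
    Tendsto (fun t => h (x t) k / t) (𝓝[≠] 0) (𝓝 0) ∧
      (ξ.2 = 0 → Tendsto (fun t => h (x t) k / t ^ 2) (𝓝[≠] 0) (𝓝 0)) := by
  obtain ⟨V, hV, hsV⟩ := hs
  have hk : ContDiffAt ℝ 2 (fun y => h y k) 0 :=
    contDiffAt_pi.mp (contDiffAt_infty.mp (hsV.contDiffAt hV) 2) k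
  have hno : (fun y => h y k) =o[𝓝 0]
      (fun x : (Fin n → ℂ) × (Fin d → ℝ) => ‖x.1‖ ^ 2 + ‖x.2‖) := isLittleO_pi.mp hn k
  have h0 : h 0 k = 0 :=
    hno.isBigO.eq_zero_imp.self_of_nhds (by simp)
  have hlin : (fun x : (Fin n → ℂ) × (Fin d → ℝ) => ‖x.1‖ ^ 2 + ‖x.2‖) =O[𝓝 0] fun x => x := by
    refine IsBigO.of_bound 2 ?_
    filter_upwards [Metric.ball_mem_nhds (0 : (Fin n → ℂ) × (Fin d → ℝ)) one_pos] with y hy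
    have h1 : ‖y‖ < 1 := by simpa using hy
    have h2 := norm_fst_le y
    have h3 := norm_snd_le y
    rw [Real.norm_of_nonneg (by positivity)]
    nlinarith [norm_nonneg y.1]
  have hd0 : HasFDerivAt (fun y => h y k) (0 : (Fin n → ℂ) × (Fin d → ℝ) →L[ℝ] ℝ) 0 := by
    rw [hasFDerivAt_iff_isLittleO]
    simpa [h0] using hno.trans_isBigO hlin
  have hlim := tendsto_div_sq_of_hasDerivAt hk hd0.fderiv hx hx0
  simp only [h0, sub_zero] at hlim
  refine ⟨tendsto_div_of_div_sq hlim, fun hξ => ?_⟩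
  have hline : HasDerivAt (fun t : ℝ => t • ξ) ξ 0 := by
    simpa using (hasDerivAt_id (0 : ℝ)).smul_const ξ
  -- Along `x` the `u`-part is only known to be `o(t)`, too weak for a direct estimate. But `h` is
  -- C² with critical point 0, so the limit depends on `ξ` alone and can be computed on the line `t
  -- ξ`, where `u = 0`.
  have hlim2 := tendsto_div_sq_of_hasDerivAt hk hd0.fderiv hline (zero_smul _ _)
  simp only [h0, sub_zero] at hlim2
  have hz : Tendsto (fun t : ℝ => h (t • ξ) k / t ^ 2) (𝓝[≠] 0) (𝓝 0) := by
    have hc : Tendsto (fun t : ℝ => t • ξ) (𝓝[≠] 0) (𝓝 0) := by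
      have := hline.continuousAt.tendsto
      rw [zero_smul] at this
      exact this.mono_left nhdsWithin_le_nhds
    refine ((hno.comp_tendsto hc).trans_isBigO ?_).tendsto_div_nhds_zero
    refine IsBigO.of_bound (‖ξ.1‖ ^ 2) (Eventually.of_forall fun t => ?_)
    simp [hξ, norm_smul, mul_pow, mul_comm]
  rwa [tendsto_nhds_unique hlim2 hz] at hlim

variable {M : Set (Fin N → ℂ)} {p : Fin N → ℂ} {U : Set (Fin N → ℂ)}
  {ρ : (Fin N → ℂ) → Fin d → ℝ} {A : Fin d → Matrix (Fin n) (Fin n) ℂ}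
  {Φ : OpenPartialHomeomorph (Fin N → ℂ) ((Fin n → ℂ) × (Fin d → ℂ))}
  {h : (Fin n → ℂ) × (Fin d → ℝ) → Fin d → ℝ}

theorem IsGenericDefiningFunction.contDiffAt (hρ : IsGenericDefiningFunction M p U ρ) :
    ContDiffAt ℝ 2 ρ p :=
  contDiffAt_infty.mp (hρ.contDiffOn.contDiffAt (hρ.isOpen.mem_nhds hρ.mem)) 2

theorem IsGenericDefiningFunction.exists_curve (hρ : IsGenericDefiningFunction M p U ρ)
    (hp : p ∈ M) {u : Fin N → ℂ} (hu : fderiv ℝ ρ p u = 0) :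
    ∃ γ : ℝ → Fin N → ℂ, γ 0 = p ∧ HasDerivAt γ u 0 ∧ ∀ᶠ t in 𝓝 0, γ t ∈ M ∧ ρ (γ t) = 0 := by
  have hstrict := hρ.contDiffAt.hasStrictFDerivAt (by norm_num)
  obtain ⟨γ, h0, hγ, hev⟩ := exists_curve_of_mem_ker hstrict
    (range_fderiv_eq_top hstrict.hasFDerivAt.differentiableAt (hρ.generic p hρ.mem)) hu
  have hρp : ρ p = 0 := (hρ.zeroSet p hρ.mem).mp hp
  have hU : ∀ᶠ t in 𝓝 0, γ t ∈ U := by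
    refine hγ.continuousAt.eventually_mem ?_
    rw [h0]; exact hρ.isOpen.mem_nhds hρ.mem
  refine ⟨γ, h0, hγ, ?_⟩
  filter_upwards [hev, hU] with t ht htU
  rw [hρp] at ht
  exact ⟨(hρ.zeroSet _ htU).mpr ht, ht⟩

theorem IsReducedFormAt.hasFDerivAt (hred : IsReducedFormAt M p A Φ h) :
    HasFDerivAt Φ (fderiv ℂ Φ p) p :=
  (hred.holomorphic.differentiableAt (Φ.open_source.mem_nhds hred.mem_source)).hasFDerivAt

/-- The chain rule for both compositions with `Φ.symm` makes the two differentials mutually inverse.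
-/
theorem IsReducedFormAt.fderiv_bijective (hred : IsReducedFormAt M p A Φ h) :
    Function.Bijective (fderiv ℂ Φ p) := by
  have hA := hred.hasFDerivAt
  have hmem : Φ p ∈ Φ.target := Φ.map_source hred.mem_source
  have hB : HasFDerivAt Φ.symm (fderiv ℂ Φ.symm (Φ p)) (Φ p) :=
    (hred.holomorphic_symm.differentiableAt (Φ.open_target.mem_nhds hmem)).hasFDerivAt
  have hBA := (hB.comp p hA).unique ((hasFDerivAt_id p).congr_of_eventuallyEq
    (by filter_upwards [Φ.eventually_left_inverse hred.mem_source] with x hx using hx))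
  have hA' : HasFDerivAt Φ (fderiv ℂ Φ p) (Φ.symm (Φ p)) := by
    rwa [Φ.left_inv hred.mem_source]
  have hAB := (hA'.comp (Φ p) hB).unique ((hasFDerivAt_id (Φ p)).congr_of_eventuallyEq
    (by filter_upwards [Φ.eventually_right_inverse hmem] with x hx using hx))
  exact ⟨Function.LeftInverse.injective fun x => DFunLike.congr_fun hBA x,
    Function.RightInverse.surjective fun x => DFunLike.congr_fun hAB x⟩

/-- Along curves in `M`, the reduced equations hold to second order. -/
theorem IsReducedFormAt.tendsto_im (hred : IsReducedFormAt M p A Φ h) {γ : ℝ → Fin N → ℂ}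
    {u : Fin N → ℂ} (hγ0 : γ 0 = p) (hγ : HasDerivAt γ u 0) (hM : ∀ᶠ t in 𝓝 0, γ t ∈ M)
    (k : Fin d) :
    ((fderiv ℂ Φ p u).2 k).im = 0 ∧ ((∀ l, ((fderiv ℂ Φ p u).2 l).re = 0) →
      Tendsto (fun t => ((Φ (γ t)).2 k).im / t ^ 2) (𝓝[≠] 0)
        (𝓝 (reQuad (A k) (fderiv ℂ Φ p u).1))) := by
  set B := fderiv ℂ Φ p
  have hΦγ : HasDerivAt (fun t => Φ (γ t)) (B u) 0 := by
    have h1 : HasFDerivAt Φ (B.restrictScalars ℝ) (γ 0) := by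
      rw [hγ0]; exact hred.hasFDerivAt.restrictScalars ℝ
    exact h1.comp_hasDerivAt (0 : ℝ) hγ
  have hΦ0 : Φ (γ 0) = 0 := by rw [hγ0, hred.map_base]
  have hZ : HasDerivAt (fun t => (Φ (γ t)).1) (B u).1 0 := hΦγ.fst
  have hW : ∀ l, HasDerivAt (fun t => (Φ (γ t)).2 l) ((B u).2 l) 0 := fun l =>
    hasDerivAt_pi.mp hΦγ.snd l
  have hWre : HasDerivAt (fun t => fun l => ((Φ (γ t)).2 l).re) (fun l => ((B u).2 l).re) 0 :=
    hasDerivAt_pi.mpr fun l => Complex.reCLM.hasFDerivAt.comp_hasDerivAt (0 : ℝ) (hW l)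
  have hWim : HasDerivAt (fun t => ((Φ (γ t)).2 k).im) ((B u).2 k).im 0 :=
    Complex.imCLM.hasFDerivAt.comp_hasDerivAt (0 : ℝ) (hW k)
  obtain ⟨hh1, hh2⟩ := negligible_along_curve hred.smooth hred.negligible k (hZ.prodMk hWre)
    (by simp [hΦ0]; rfl)
  have hQ := tendsto_reQuad_div_sq (A k) hZ (by simp [hΦ0])
  have heq : ∀ᶠ t in 𝓝[≠] (0 : ℝ), ((Φ (γ t)).2 k).im = reQuad (A k) (Φ (γ t)).1 +
      h ((Φ (γ t)).1, fun l => ((Φ (γ t)).2 l).re) k := by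
    have hc : Tendsto γ (𝓝 0) (𝓝 p) := by
      have := hγ.continuousAt.tendsto
      rwa [hγ0] at this
    refine Eventually.filter_mono nhdsWithin_le_nhds ?_
    filter_upwards [hc.eventually hred.equation, hM] with t ht htM
    have h1 := congrArg Complex.re (ht.mp htM k)
    simpa [reQuad] using h1
  constructor
  · have h1 : Tendsto (fun t => ((Φ (γ t)).2 k).im / t) (𝓝[≠] 0) (𝓝 ((B u).2 k).im) := by
      have := hWim.tendsto_slope_zero
      simp only [zero_add, hΦ0] at this
      refine this.congr fun t => ?_
      simp [div_eq_inv_mul]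
    have h2 := (tendsto_div_of_div_sq hQ).add hh1
    rw [add_zero] at h2
    refine tendsto_nhds_unique h1 (h2.congr' ?_)
    filter_upwards [heq] with t ht
    rw [ht, add_div]
  · intro hre
    have h2 := hQ.add (hh2 (by ext l; exact hre l))
    rw [add_zero] at h2
    refine h2.congr' ?_
    filter_upwards [heq] with t ht
    rw [ht, add_div]

/-- Compose `φ` with a linear section of `D`; two lifts differ by an element of the kernel. This
produces the Lagrange multiplier `T` with `dg = T ∘ dρ`. -/
theorem exists_comp_eq_of_ker_le {V W F : Type*} [AddCommGroup V] [Module ℝ V]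
    [AddCommGroup W] [Module ℝ W] [AddCommGroup F] [Module ℝ F] (D : V →ₗ[ℝ] W)
    (hD : LinearMap.range D = ⊤) (φ : V →ₗ[ℝ] F) (h : ∀ v, D v = 0 → φ v = 0) :
    ∃ T : W →ₗ[ℝ] F, ∀ v, T (D v) = φ v := by
  obtain ⟨s, hs⟩ := D.exists_rightInverse_of_surjective hD
  refine ⟨φ ∘ₗ s, fun v => ?_⟩
  have h1 : D (s (D v) - v) = 0 := by
    rw [map_sub, sub_eq_zero]
    exact LinearMap.congr_fun hs (D v)
  have h2 := h _ h1
  rw [map_sub, sub_eq_zero] at h2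
  exact h2

/-- The Levi form of the reduced equations is a combination of the Levi forms of any defining
functions. -/
theorem exists_levi_form_eq (hp : p ∈ M) (hρ : IsGenericDefiningFunction M p U ρ)
    (hred : IsReducedFormAt M p A Φ h) (k : Fin d) :
    ∃ T : (Fin d → ℝ) →L[ℝ] ℝ, ∀ v y : Fin N → ℂ,
      fderiv ℝ ρ p v = 0 → fderiv ℝ ρ p (Complex.I • v) = 0 →
      fderiv ℝ ρ p y = 0 → fderiv ℝ ρ p (Complex.I • y) = 0 →
      2 * (reQuad (A k) ((fderiv ℂ Φ p v).1 + (fderiv ℂ Φ p y).1) -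
          reQuad (A k) (fderiv ℂ Φ p v).1 - reQuad (A k) (fderiv ℂ Φ p y).1) =
        T (fderiv ℝ (fderiv ℝ ρ) p v y +
          fderiv ℝ (fderiv ℝ ρ) p (Complex.I • v) (Complex.I • y)) := by
  set B := fderiv ℂ Φ p with hB
  set g : (Fin N → ℂ) → ℝ := fun x => ((Φ x).2 k).im with hg
  have hol : DifferentiableOn ℂ (fun x => (Φ x).2 k) Φ.source := fun x hx =>
    (differentiableWithinAt_pi.mp (hred.holomorphic x hx).snd) k
  have hgC : ContDiffAt ℝ 2 g p := contDiffAt_im hol Φ.open_source hred.mem_source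
  have hρC := hρ.contDiffAt
  have hρd : DifferentiableAt ℝ ρ p := hρC.differentiableAt (by norm_num)
  have hρp : ρ p = 0 := (hρ.zeroSet p hρ.mem).mp hp
  have hgB : ∀ v, fderiv ℝ g p v = ((B v).2 k).im := fun v => by
    have h1 := (hred.hasFDerivAt.restrictScalars ℝ).snd
    have h2 := Complex.imCLM.hasFDerivAt.comp p (hasFDerivAt_pi'.mp h1 k)
    rw [show g = Complex.imCLM ∘ fun x => (Φ x).2 k from rfl, h2.fderiv]
    rfl
  have him : ∀ u, fderiv ℝ ρ p u = 0 → ∀ l, ((B u).2 l).im = 0 := fun u hu l => by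
    obtain ⟨γ, h0, hγ, hev⟩ := hρ.exists_curve hp hu
    exact (hred.tendsto_im h0 hγ (hev.mono fun t ht => ht.1) l).1
  -- The real part of the `w`-component of `B u` is the imaginary part of that of `B (i u)`.
  have hre : ∀ u, fderiv ℝ ρ p (Complex.I • u) = 0 → ∀ l, ((B u).2 l).re = 0 := fun u hu l => by
    simpa using him _ hu l
  obtain ⟨T₀, hT₀⟩ := exists_comp_eq_of_ker_le (fderiv ℝ ρ p : (Fin N → ℂ) →ₗ[ℝ] (Fin d → ℝ))
    (range_fderiv_eq_top hρd (hρ.generic p hρ.mem)) (fderiv ℝ g p : (Fin N → ℂ) →ₗ[ℝ] ℝ)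
    fun v hv => (hgB v).trans (him v hv k)
  set T : (Fin d → ℝ) →L[ℝ] ℝ := LinearMap.toContinuousLinearMap T₀ with hT
  have hTD : ∀ v, T (fderiv ℝ ρ p v) = fderiv ℝ g p v := hT₀
  -- Subtracting `T ρ` makes `p` a critical point without changing `g` on the curves in `M`, so the
  -- limit along a curve reads off the Hessian.
  set G : (Fin N → ℂ) → ℝ := fun x => g x - T (ρ x) with hG
  have hGC : ContDiffAt ℝ 2 G p := hgC.sub (T.contDiff.contDiffAt.comp p hρC)
  have hGfd : ∀ᶠ x in 𝓝 p, fderiv ℝ G x = fderiv ℝ g x - T ∘L fderiv ℝ ρ x := by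
    filter_upwards [hgC.eventually (by simp), hρC.eventually (by simp)] with x h1 h2
    have h1 := (h1.differentiableAt (by norm_num)).hasFDerivAt
    have h2 := (h2.differentiableAt (by norm_num)).hasFDerivAt
    exact (h1.sub (T.hasFDerivAt.comp x h2)).fderiv
  have hG0 : fderiv ℝ G p = 0 := by
    rw [hGfd.self_of_nhds]
    ext v
    simp [hTD]
  have hdd : ∀ {F : Type} [NormedAddCommGroup F] [NormedSpace ℝ F] {f : (Fin N → ℂ) → F},
      ContDiffAt ℝ 2 f p → HasFDerivAt (fderiv ℝ f) (fderiv ℝ (fderiv ℝ f) p) p := fun hf =>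
    ((hf.fderiv_right (m := 1) (by norm_num)).differentiableAt (by norm_num)).hasFDerivAt
  have hGG : ∀ v y, fderiv ℝ (fderiv ℝ G) p v y =
      fderiv ℝ (fderiv ℝ g) p v y - T (fderiv ℝ (fderiv ℝ ρ) p v y) := fun v y => by
    have h1 := (hdd hgC).clm_apply (hasFDerivAt_const y p)
    have h2 := T.hasFDerivAt.comp p ((hdd hρC).clm_apply (hasFDerivAt_const y p))
    have h3 := (hdd hGC).clm_apply (hasFDerivAt_const y p)
    have h4 : (fun x => fderiv ℝ G x y) =ᶠ[𝓝 p]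
        fun x => fderiv ℝ g x y - (T ∘ fun x => fderiv ℝ ρ x y) x := by
      filter_upwards [hGfd] with x hx
      rw [hx]; rfl
    have h5 := DFunLike.congr_fun (h3.unique ((h1.sub h2).congr_of_eventuallyEq h4)) v
    simpa using h5
  have hquad : ∀ u, fderiv ℝ ρ p u = 0 → fderiv ℝ ρ p (Complex.I • u) = 0 →
      fderiv ℝ (fderiv ℝ G) p u u = 2 * reQuad (A k) (B u).1 := fun u hu hIu => by
    obtain ⟨γ, h0, hγ, hev⟩ := hρ.exists_curve hp hu
    have h1 := (hred.tendsto_im h0 hγ (hev.mono fun t ht => ht.1) k).2 (hre u hIu)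
    have h2 := tendsto_div_sq_of_hasDerivAt hGC hG0 hγ h0
    have hGp : G p = 0 := by simp [hG, hg, hρp, hred.map_base]
    have h3 := tendsto_nhds_unique h2 (h1.congr' ?_)
    · linarith
    · filter_upwards [Eventually.filter_mono nhdsWithin_le_nhds hev] with t ht
      rw [hGp]
      simp [hG, hg, ht.2]
  have hsymm : ∀ v w, fderiv ℝ (fderiv ℝ G) p v w = fderiv ℝ (fderiv ℝ G) p w v := fun v w =>
    (hGC.isSymmSndFDerivAt (by simp)).eq v w
  have hpolar : ∀ v y, fderiv ℝ ρ p v = 0 → fderiv ℝ ρ p (Complex.I • v) = 0 →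
      fderiv ℝ ρ p y = 0 → fderiv ℝ ρ p (Complex.I • y) = 0 →
      fderiv ℝ (fderiv ℝ G) p v y = reQuad (A k) ((B v).1 + (B y).1) -
          reQuad (A k) (B v).1 - reQuad (A k) (B y).1 := fun v y hv hIv hy hIy => by
    have h1 := hquad v hv hIv
    have h2 := hquad y hy hIy
    have h3 := hquad (v + y) (by rw [map_add, hv, hy, add_zero])
      (by rw [smul_add, map_add, hIv, hIy, add_zero])
    simp only [map_add, _root_.add_apply, Prod.fst_add] at h3
    rw [h1, h2, hsymm y v] at h3
    linarith
  have hII : ∀ v : Fin N → ℂ, Complex.I • Complex.I • v = -v := fun v => by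
    rw [smul_smul, Complex.I_mul_I, neg_one_smul]
  -- Add the polar identities for `(v, y)` and `(i v, i y)`: the form of `A k` is `i`-invariant,
  -- which gives the factor 2, the Hessian of `g` cancels, and only `-T` of the Levi form of `ρ` is
  -- left.
  refine ⟨-T, fun v y hv hIv hy hIy => ?_⟩
  have h1 := hpolar v y hv hIv hy hIy
  have h2 := hpolar (Complex.I • v) (Complex.I • y) hIv (by rw [hII, map_neg, hv, neg_zero]) hIy
    (by rw [hII, map_neg, hy, neg_zero])
  simp only [map_smul, Prod.smul_fst, ← smul_add, reQuad_I_smul] at h2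
  have h3 := fderiv_fderiv_im_add hol Φ.open_source hred.mem_source v y
  rw [hGG] at h1 h2
  simp only [_root_.neg_apply, map_add]
  linarith

theorem finrank_ker_ge {ρ' : (Fin N → ℂ) →ₗ[ℂ] (Fin d → ℂ)} :
    N ≤ Module.finrank ℂ (LinearMap.ker ρ') + d := by
  have h1 := LinearMap.finrank_range_add_finrank_ker ρ'
  have h2 := Submodule.finrank_le (LinearMap.range ρ')
  simp only [Module.finrank_fin_fun] at h1 h2
  omega

/-- The differential `∂ρ(p)`, up to a factor, as a `ℂ`-linear map. -/
noncomputable def complexDifferential (D : (Fin N → ℂ) →L[ℝ] (Fin d → ℝ)) :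
    (Fin N → ℂ) →ₗ[ℂ] (Fin d → ℂ) where
  toFun v k := (D v k : ℂ) - Complex.I * D (Complex.I • v) k
  map_add' x y := by ext k; simp; ring
  map_smul' c v := by
    ext k
    have h1 : c • v = c.re • v + c.im • (Complex.I • v) := by
      ext i
      simp only [Pi.smul_apply, Pi.add_apply, smul_eq_mul, Complex.real_smul]
      conv_lhs => rw [← Complex.re_add_im c]
      ring
    have h2 : Complex.I • c • v = c.re • (Complex.I • v) - c.im • v := by
      rw [h1, smul_add, smul_comm _ c.re, smul_comm _ c.im, smul_smul, Complex.I_mul_I,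
        neg_one_smul, smul_neg, sub_eq_add_neg]
    rw [h2, h1]
    simp only [map_add, map_sub, map_smul, Pi.add_apply, Pi.sub_apply, Pi.smul_apply, smul_eq_mul,
      RingHom.id_apply, Complex.ofReal_add, Complex.ofReal_sub, Complex.ofReal_mul]
    conv_rhs => rw [← Complex.re_add_im c]
    linear_combination ((c.im : ℂ) * D (Complex.I • v) k) * Complex.I_mul_I

theorem mem_ker_complexDifferential {D : (Fin N → ℂ) →L[ℝ] (Fin d → ℝ)} {v : Fin N → ℂ} :
    v ∈ LinearMap.ker (complexDifferential D) ↔ D v = 0 ∧ D (Complex.I • v) = 0 := by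
  rw [LinearMap.mem_ker, funext_iff, funext_iff, funext_iff, ← forall_and]
  refine forall_congr' fun k => ?_
  simp [complexDifferential, Complex.ext_iff]

/-- Under condition (b), the Levi form of any defining function is nondegenerate on the complex
tangent space. -/
theorem eq_zero_of_levi_form_eq_zero (hp : p ∈ M) (hρ : IsGenericDefiningFunction M p U ρ)
    (hred : IsReducedFormAt M p A Φ h) (hb : ConditionB A) {v : Fin N → ℂ}
    (hv : fderiv ℝ ρ p v = 0) (hIv : fderiv ℝ ρ p (Complex.I • v) = 0)
    (hL : ∀ y, fderiv ℝ ρ p y = 0 → fderiv ℝ ρ p (Complex.I • y) = 0 →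
      fderiv ℝ (fderiv ℝ ρ) p v y +
        fderiv ℝ (fderiv ℝ ρ) p (Complex.I • v) (Complex.I • y) = 0) : v = 0 := by
  obtain ⟨hinj, hsurj⟩ := hred.fderiv_bijective
  set B := fderiv ℂ Φ p with hB
  have hN : n + d = N := by
    have := (LinearEquiv.ofBijective
      (B : (Fin N → ℂ) →ₗ[ℂ] (Fin n → ℂ) × (Fin d → ℂ)) ⟨hinj, hsurj⟩).finrank_eq
    simpa using this.symm
  set K := LinearMap.ker (complexDifferential (fderiv ℝ ρ p)) with hK
  have him : ∀ u, fderiv ℝ ρ p u = 0 → ∀ l, ((B u).2 l).im = 0 := fun u hu l => by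
    obtain ⟨γ, h0, hγ, hev⟩ := hρ.exists_curve hp hu
    exact (hred.tendsto_im h0 hγ (hev.mono fun t ht => ht.1) l).1
  have hsnd : ∀ u ∈ K, (B u).2 = 0 := fun u hu => by
    rw [hK, mem_ker_complexDifferential] at hu
    ext l
    refine Complex.ext ?_ (him u hu.1 l)
    simpa using him _ hu.2 l
  let z : K →ₗ[ℂ] (Fin n → ℂ) := LinearMap.fst ℂ _ _ ∘ₗ
    (B : (Fin N → ℂ) →ₗ[ℂ] (Fin n → ℂ) × (Fin d → ℂ)) ∘ₗ K.subtype
  have hzinj : Function.Injective z := by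
    rw [← LinearMap.ker_eq_bot, LinearMap.ker_eq_bot']
    intro u hu
    refine Subtype.ext (hinj ?_)
    rw [ZeroMemClass.coe_zero, map_zero]
    exact Prod.ext hu (hsnd u u.2)
  -- The complex tangent space `K` has dimension at least `N - d = n` and embeds in `ℂ^n`.
  -- Surjectivity lets every test vector `b` come from a complex tangent vector.
  have hzsurj : Function.Surjective z := by
    have h1 := LinearMap.finrank_le_finrank_of_injective hzinj
    have h2 : N ≤ Module.finrank ℂ K + d := finrank_ker_ge
    rw [Module.finrank_fin_fun] at h1
    refine (LinearMap.injective_iff_surjective_of_finrank_eq_finrank ?_).mp hzinj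
    rw [Module.finrank_fin_fun]
    omega
  have hz0 : (B v).1 = 0 := by
    have h1 : (B v).1 ∈ (⨅ k, LinearMap.ker (A k).mulVecLin : Submodule ℂ (Fin n → ℂ)) := by
      rw [Submodule.mem_iInf]
      intro k
      rw [LinearMap.mem_ker, Matrix.mulVecLin_apply]
      refine mulVec_eq_zero_of_reQuad (hred.hermitian k) fun b => ?_
      obtain ⟨⟨y, hy⟩, rfl⟩ := hzsurj b
      obtain ⟨T, hT⟩ := exists_levi_form_eq hp hρ hred k
      rw [hK, mem_ker_complexDifferential] at hy
      have h2 := hT v y hv hIv hy.1 hy.2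
      rw [hL y hy.1 hy.2, map_zero] at h2
      change reQuad (A k) ((B v).1 + (B y).1) - _ - reQuad (A k) (B y).1 = 0
      linarith
    have h2 : (⨅ k, LinearMap.ker (A k).mulVecLin : Submodule ℂ (Fin n → ℂ)) = ⊥ := hb
    rw [h2] at h1
    simpa using h1
  refine hinj ?_
  rw [map_zero]
  exact Prod.ext hz0 (hsnd v (mem_ker_complexDifferential.mpr ⟨hv, hIv⟩))

end Reduced

end CRGeometry

/-! ### Conclusion: the Taylor series of `ρ` is 1-nondegenerate. -/

theorem mainTheorem5 {N n d : ℕ} (M : Set (Fin N → ℂ)) (p : Fin N → ℂ) (hp : p ∈ M)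
    (hM : CRGeometry.IsSmoothGenericSubmanifold M d)
    (A : Fin d → Matrix (Fin n) (Fin n) ℂ)
    (Φ : OpenPartialHomeomorph (Fin N → ℂ) ((Fin n → ℂ) × (Fin d → ℂ)))
    (h : (Fin n → ℂ) × (Fin d → ℝ) → Fin d → ℝ)
    (hred : CRGeometry.IsReducedFormAt M p A Φ h)
    (hb : CRGeometry.ConditionB A) :
    CRGeometry.IsFormallyHolNondegenerateAt M d p := by
  rintro ⟨X, hX0, U, ρ, hρ, c, hc⟩
  have hρC := hρ.contDiffAt
  have hρd : DifferentiableAt ℝ ρ p := hρC.differentiableAt (by norm_num)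
  have hρp : ρ p = 0 := (hρ.zeroSet p hρ.mem).mp hp
  have hker : ∀ v, (∀ k, ∑ j, v j * CRGeometry.dZ j (fun W => (ρ W k : ℂ)) p = 0) →
      fderiv ℝ ρ p v = 0 ∧ fderiv ℝ ρ p (Complex.I • v) = 0 := fun v hv => by
    rw [← CRGeometry.mem_ker_complexDifferential, LinearMap.mem_ker]
    ext k
    have h1 := hv k
    rw [CRGeometry.sum_mul_dZ hρd] at h1
    simpa [CRGeometry.complexDifferential] using h1
  refine hX0 (CRGeometry.FormalHolVectorField.eq_zero_of_act_eq
    (ρ := fun k => CRGeometry.taylorSeries (fun Z => (ρ Z k : ℂ)) p) ?_ ?_ ?_ X c hc)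
  · intro k
    rw [CRGeometry.constantCoeff_taylorSeries, hρp]
    simp
  -- As `ρ` is real, the rows `∂̄ρ_k` are conjugate to the rows `∂ρ_k`, and independence is
  -- preserved by conjugation.
  · simp only [CRGeometry.coeff_inr_taylorSeries, CRGeometry.dZbar_ofReal hρd]
    rw [Fintype.linearIndependent_iff]
    intro g hg k
    have h1 := Fintype.linearIndependent_iff.mp (hρ.generic p hρ.mem) (fun k => star (g k)) (by
      ext j
      have h2 := congrArg star (congrFun hg j)
      simpa using h2) k
    simpa using h1
  · intro v hv hvw
    simp only [CRGeometry.coeff_inl_taylorSeries] at hv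
    simp only [CRGeometry.coeff_inr_taylorSeries, CRGeometry.coeff_inl_inr_taylorSeries,
      CRGeometry.dZbar_ofReal hρd] at hvw
    obtain ⟨hv0, hIv0⟩ := hker v hv
    refine CRGeometry.eq_zero_of_levi_form_eq_zero hp hρ hred hb hv0 hIv0 fun y hy hIy => ?_
    -- Conjugates of (1,0) tangent vectors are the (0,1) ones. The real part of the complex Levi
    -- form is, up to the factor 1/4, the symmetric expression required in `hL`.
    have h1 := hvw (star y) (fun k => by
      have h2 : ∑ l, y l * CRGeometry.dZ l (fun W => (ρ W k : ℂ)) p = 0 := by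
        rw [CRGeometry.sum_mul_dZ hρd, hy, hIy]; simp
      have h3 := congrArg star h2
      simpa using h3)
    ext k
    have h4 := h1 k
    simp only [Pi.star_apply] at h4
    rw [CRGeometry.sum_mul_dZ_dZbar hρC] at h4
    have h5 := congrArg Complex.re h4
    simpa [← Complex.ofReal_add, ← Complex.ofReal_sub] using h5
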